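/- Let $SO(3)$ carry the Riemannian metric $\langle V,W\rangle=\tfrac12\operatorname{tr}(V^{T}W)$ on $T_RSO(3)=\{RA: A^T=-A\}$, with Riemannian distance $d$. Let $K(R,Q)=g(d(R,Q)^2)$ for $R,Q\in SO(3)$, where $g:[0,\infty)\to\mathbb R$ is differentiable with locally Lipschitz continuous derivative. Let $0<\varepsilon<\pi/2$, let $\mathcal D_\varepsilon=\{R\in SO(3): d(I,R)<\pi/2-\varepsilon\}$, let $\mathcal P(\mathcal D_\varepsilon)$ be the set of Borel probability measures on $\mathcal D_\varepsilon$ with the narrow topology, and let $\rho_0\in\mathcal P(\mathcal D_\varepsilon)$ have compact support in $\mathcal D_\varepsilon$. For a curve $(\rho_t)_{t\in[0,T)}$ in $\mathcal P(\mathcal D_\varepsilon)$ put $v[\rho](R,t)=-\int_{\mathcal D_\varepsilon}\nabla K_Q(R)\,\mathrm d\rho_t(Q)$, where $K_Q(R)=K(R,Q)$ and $\nabla$ is the Riemannian gradient. The curve is called a weak solution of the aggregation equation $$\partial_t\rho+\nabla\cdot(\rho v)=0,\qquad v=-\nabla K*\rho,$$ if there is a unique flow map $\Psi:\operatorname{supp}(\rho_0)\times[0,T)\to\mathcal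 D_\varepsilon$ with $\frac{\mathrm d}{\mathrm dt}\Psi^t(R)=v[\rho](\Psi^t(R),t)$ and $\Psi^0(R)=R$ for all $R\in\operatorname{supp}(\rho_0)$ and $t\in[0,T)$, and $\rho_t=\Psi^t\#\rho_0$ for all $t\in[0,T)$. Then there exist $T>0$ and a unique weak solution $\rho\in C([0,T);\mathcal P(\mathcal D_\varepsilon))$ starting from $\rho_0$. -/

import Mathlib

open Set MeasureTheory
open scoped Matrix Topology NNReal

namespace AggregationSO3

/-- Real `3 × 3` matrices, the ambient space of the rotation group. -/
abbrev Mat3 : Type := Matrix (Fin 3) (Fin 3) ℝ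

/-- The rotation group `SO(3)`, with the topology induced by the space of matrices. -/
abbrev SO3 : Type := Matrix.specialOrthogonalGroup (Fin 3) ℝ

/-- The Borel `σ`-algebra of `SO(3)`. -/
instance instMeasurableSpaceSO3 : MeasurableSpace SO3 := borel SO3

instance instBorelSpaceSO3 : BorelSpace SO3 := ⟨rfl⟩

/-- The tangent space `T_R SO(3) = {R A : A skew-symmetric}`, inside the space of matrices. -/
def tangentSpace (R : SO3) : Set Mat3 := {V | ∃ A : Mat3, Aᵀ = -A ∧ V = (R : Mat3) * A}

/-- The Riemannian metric of `SO(3)`: one half of the Frobenius inner product. -/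
noncomputable def metric (V W : Mat3) : ℝ := (1 / 2) * (Vᵀ * W).trace

/-- `IsC1Path γ γ' R Q`: the restriction of `γ` to `[0,1]` is a `C¹` path in `SO(3)` from `R` to
`Q`, with velocity `γ'`. -/
def IsC1Path (γ : ℝ → SO3) (γ' : ℝ → Mat3) (R Q : SO3) : Prop :=
  γ 0 = R ∧ γ 1 = Q ∧ ContinuousOn γ' (Icc 0 1) ∧
    ∀ t ∈ Icc (0 : ℝ) 1, HasDerivWithinAt (fun s => (γ s : Mat3)) (γ' t) (Icc 0 1) t

/-- The length of a path with velocity `γ'` on `[0,1]`. -/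
noncomputable def pathLength (γ' : ℝ → Mat3) : ℝ :=
  ∫ t in (0 : ℝ)..1, Real.sqrt (metric (γ' t) (γ' t))

/-- The Riemannian distance `d(R,Q)` of `SO(3)`: the infimum of the lengths of the `C¹` paths
from `R` to `Q`. -/
noncomputable def riemannianDist (R Q : SO3) : ℝ :=
  sInf {l : ℝ | ∃ (γ : ℝ → SO3) (γ' : ℝ → Mat3), IsC1Path γ γ' R Q ∧ l = pathLength γ'}

/-- `V` is the Riemannian gradient of `f` at `R`: it is tangent at `R`, and along every curve `γ`
in `SO(3)` through `R` with velocity `W` at `R`, the derivative of `f` is `⟨V, W⟩`. -/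
def IsGradientAt (f : SO3 → ℝ) (R : SO3) (V : Mat3) : Prop :=
  V ∈ tangentSpace R ∧
    ∀ (γ : ℝ → SO3) (W : Mat3), γ 0 = R → HasDerivAt (fun s => (γ s : Mat3)) W 0 →
      HasDerivAt (fun s => f (γ s)) (metric V W) 0

open Classical in
/-- The Riemannian gradient `∇f(R)` (zero by convention where `f` has no gradient). -/
noncomputable def gradient (f : SO3 → ℝ) (R : SO3) : Mat3 :=
  if h : ∃ V, IsGradientAt f R V then h.choose else 0

/-- The interaction potential has the form `K(R,Q) = g(d(R,Q)²)`, where `g : [0,∞) → ℝ` is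
differentiable with locally Lipschitz continuous derivative. (Only the values of `g` on `[0,∞)`
enter; the derivative at `0` is one-sided.) -/
def IsAdmissiblePotential (K : SO3 → SO3 → ℝ) : Prop :=
  ∃ g : ℝ → ℝ, DifferentiableOn ℝ g (Ici 0) ∧
    LocallyLipschitzOn (Ici 0) (derivWithin g (Ici 0)) ∧
    ∀ R Q : SO3, K R Q = g (riemannianDist R Q ^ 2)

/-- The open geodesic disk of radius `r` centred at the identity. -/
def geodesicDisk (r : ℝ) : Set SO3 := {R | riemannianDist 1 R < r}

/-- The velocity field `v[ρ](R,t) = -(∇K * ρ_t)(R) = -∫ ∇K_Q(R) dρ_t(Q)` on `U`, where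
`K_Q(R) = K(R,Q)`; the matrix-valued integral is taken entrywise. -/
noncomputable def velocity (K : SO3 → SO3 → ℝ) {U : Set SO3} (ρ : ℝ → ProbabilityMeasure U)
    (R : U) (t : ℝ) : Mat3 :=
  Matrix.of fun i j => -∫ Q : U, gradient (fun P => K P (Q : SO3)) (R : SO3) i j ∂(ρ t : Measure U)

/-- `Ψ` restricts to a flow map `Σ × [0,T) → U` generated by `(X, Σ)`, that is
`d/dt Ψ^t(R) = X(Ψ^t(R), t)` for `t ∈ [0,T)` (one-sided at `0`) and `Ψ^0(R) = R`, for all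
`R ∈ Σ`. Values of `Ψ` outside `Σ × [0,T)` play no role. -/
def IsFlowMap {U : Set SO3} (X : U → ℝ → Mat3) (S : Set U) (T : ℝ) (Ψ : U → ℝ → U) : Prop :=
  ∀ R ∈ S, Ψ R 0 = R ∧
    ∀ t ∈ Ico (0 : ℝ) T,
      HasDerivWithinAt (fun s => ((Ψ R s : SO3) : Mat3)) (X (Ψ R t) t) (Ico 0 T) t

/-- `(ρ_t)`, `t ∈ [0,T)`, is a weak solution in `U` of the aggregation equation
`∂_t ρ + ∇·(ρ v) = 0`, `v = -∇K * ρ`: the field `v[ρ]` generates a unique flow map on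
`supp(ρ_0) × [0,T)`, and `ρ_t` is the push-forward of `ρ_0` by this flow map. -/
def IsWeakSolution (K : SO3 → SO3 → ℝ) {U : Set SO3} (T : ℝ)
    (ρ : ℝ → ProbabilityMeasure U) : Prop :=
  ∃ Ψ : U → ℝ → U,
    IsFlowMap (velocity K ρ) (ρ 0 : Measure U).support T Ψ ∧
    (∀ Φ : U → ℝ → U, IsFlowMap (velocity K ρ) (ρ 0 : Measure U).support T Φ →
      ∀ R ∈ (ρ 0 : Measure U).support, ∀ t ∈ Ico (0 : ℝ) T, Φ R t = Ψ R t) ∧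
    ∀ t ∈ Ico (0 : ℝ) T,
      (ρ t : Measure U) = Measure.map (fun R => Ψ R t) (ρ 0 : Measure U)

/-- `ρ ∈ C([0,T); P(U))`, with the narrow topology on `P(U)`, is a weak solution of the
aggregation equation that starts from `ρ₀`. -/
def IsWeakSolutionFrom (K : SO3 → SO3 → ℝ) {U : Set SO3} (ρ₀ : ProbabilityMeasure U) (T : ℝ)
    (ρ : ℝ → ProbabilityMeasure U) : Prop :=
  ContinuousOn ρ (Ico 0 T) ∧ ρ 0 = ρ₀ ∧ IsWeakSolution K T ρ

end AggregationSO3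

namespace AggregationSO3

/-! Two rotations in the disk of radius r = π/2 − ε make an angle θ below 2r = π − 2ε, so they stay
uniformly away from each other's cut locus (`cos_two_mul_lt_cosAngle`), and there d(R,Q) = θ =
arccos((tr RᵀQ − 1)/2) (`riemannianDist_eq_arccos`). The lower bound holds because the angle is
1-Lipschitz along C¹ paths, the upper bound because Rodrigues curves attain it. Hence −∇K_Q(R) =
g'(θ²) (θ/sin θ) R(RᵀQ − QᵀR) (`isGradientAt_potential`). As functions of cos θ in [cos 2r, 1], both
θ² and θ/sin θ are Lipschitz, even at θ = 0. Clamping the cosine to that interval therefore extends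
the force to a locally Lipschitz map on all pairs of matrices (`locallyLipschitz_force`).

Push-forward turns the equation into the ODE ∂ₜΨ(x) = ∫ force(Ψ(x), Ψ(y)) dρ₀(y) for the flow on the
compact support of ρ₀, an ODE in the Banach space of continuous matrix-valued maps. Picard–Lindelöf
solves it (`exists_meanField_solution`); tangency of the force keeps the solution in SO(3), and
openness keeps it in the disk for a short time (`exists_flow`). Uniqueness, both of the flow map for
a given field and of the weak solution, is a contraction argument on an interval with LT ≤ 1/2
(`eq_zero_of_norm_deriv_le_of_norm_le`). -/

/-- The sup norm on matrices, with the topology of `Mat3`. -/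
noncomputable instance instNormedAddCommGroupMat3 : NormedAddCommGroup Mat3 where
  toNorm := (Matrix.normedAddCommGroup : NormedAddCommGroup Mat3).toNorm
  toAddCommGroup := Matrix.addCommGroup
  toMetricSpace := (Matrix.normedAddCommGroup : NormedAddCommGroup Mat3).toMetricSpace
    |>.replaceTopology (U := instTopologicalSpaceMatrix) rfl
  dist_eq := (Matrix.normedAddCommGroup : NormedAddCommGroup Mat3).dist_eq
noncomputable instance instNormedSpaceMat3 : NormedSpace ℝ Mat3 where
  toModule := Matrix.module
  norm_smul_le :=
    (Matrix.normedSpace : @NormedSpace ℝ Mat3 _ Matrix.seminormedAddCommGroup).norm_smul_le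

/-! ### Matrix identities for rotations and the rotation angle. -/

theorem SO3.transpose_mul_self (M : SO3) : (M : Mat3)ᵀ * (M : Mat3) = 1 :=
  (Matrix.mem_orthogonalGroup_iff' (Fin 3) ℝ).1 (Matrix.mem_specialOrthogonalGroup_iff.1 M.2).1

theorem SO3.mul_transpose_self (M : SO3) : (M : Mat3) * (M : Mat3)ᵀ = 1 :=
  (Matrix.mem_orthogonalGroup_iff (Fin 3) ℝ).1 (Matrix.mem_specialOrthogonalGroup_iff.1 M.2).1

theorem SO3.det_eq_one (M : SO3) : (M : Mat3).det = 1 :=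
  (Matrix.mem_specialOrthogonalGroup_iff.1 M.2).2

theorem mem_SO3_of {M : Mat3} (h : M * Mᵀ = 1) (hd : M.det = 1) :
    M ∈ Matrix.specialOrthogonalGroup (Fin 3) ℝ :=
  Matrix.mem_specialOrthogonalGroup_iff.2 ⟨(Matrix.mem_orthogonalGroup_iff (Fin 3) ℝ).2 h, hd⟩

/-- The relative rotation `Rᵀ Q`. -/
def SO3.rel (R Q : SO3) : SO3 :=
  ⟨(R : Mat3)ᵀ * (Q : Mat3), mem_SO3_of
    (by
      rw [Matrix.transpose_mul, Matrix.transpose_transpose, Matrix.mul_assoc,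
        ← Matrix.mul_assoc (Q : Mat3), Q.mul_transpose_self, Matrix.one_mul,
        R.transpose_mul_self])
    (by rw [Matrix.det_mul, Matrix.det_transpose, R.det_eq_one, Q.det_eq_one, one_mul])⟩

theorem SO3.coe_rel (R Q : SO3) : (SO3.rel R Q : Mat3) = (R : Mat3)ᵀ * (Q : Mat3) := rfl

theorem SO3.adjugate_eq (M : SO3) : (M : Mat3).adjugate = (M : Mat3)ᵀ := by
  have h := Matrix.mul_adjugate (M : Mat3)
  rw [M.det_eq_one, one_smul] at h
  calc (M : Mat3).adjugate = ((M : Mat3)ᵀ * M) * (M : Mat3).adjugate := by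
        rw [M.transpose_mul_self, one_mul]
    _ = (M : Mat3)ᵀ := by rw [mul_assoc, h, mul_one]

/-- The Cayley–Hamilton theorem for rotations. -/
theorem SO3.mul_self_eq (M : SO3) :
    (M : Mat3) * M = (M : Mat3).trace • (M : Mat3) - (M : Mat3).trace • (1 : Mat3)
      + (M : Mat3)ᵀ := by
  have h := M.adjugate_eq
  have ht : (M : Mat3).trace = (M : Mat3).adjugate.trace := by rw [h, Matrix.trace_transpose]
  rw [← h]
  -- Every 3×3 matrix satisfies M² = tr(M) M − tr(adj M) 1 + adj M, so replacing just the second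
  -- trace leaves a polynomial identity in the entries.
  conv_rhs => enter [1, 2, 1]; rw [ht]
  ext i j
  fin_cases i <;> fin_cases j <;>
    simp [Matrix.mul_apply, Fin.sum_univ_three, Matrix.trace_fin_three, Matrix.adjugate_fin_three]
      <;> ring

theorem SO3.trace_mul_self (M : SO3) :
    ((M : Mat3) * M).trace = (M : Mat3).trace ^ 2 - 2 * (M : Mat3).trace := by
  rw [M.mul_self_eq]
  simp [Matrix.trace_add, Matrix.trace_sub, Matrix.trace_smul]
  ring

/-- The left side is ‖M‖² − tr(M²) in the Frobenius norm, with ‖M‖² = 3. As tr M = 1 + 2 cos θ, both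
sides are 4 sin² θ. -/
theorem SO3.sum_sq_sub_transpose (M : SO3) :
    ((M : Mat3) 2 1 - (M : Mat3) 1 2) ^ 2 + ((M : Mat3) 0 2 - (M : Mat3) 2 0) ^ 2
      + ((M : Mat3) 1 0 - (M : Mat3) 0 1) ^ 2 = 4 - ((M : Mat3).trace - 1) ^ 2 := by
  have h1 := congrArg Matrix.trace M.mul_transpose_self
  have h2 := M.trace_mul_self
  simp only [Matrix.trace_fin_three, Matrix.mul_apply, Fin.sum_univ_three, Matrix.transpose_apply,
    Matrix.one_apply_eq] at h1 h2 ⊢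
  linear_combination h1 - h2

/-- The square of the axis matrix is linear in M + Mᵀ by Cayley–Hamilton; this is what allows
Rodrigues' formula to be inverted. -/
theorem SO3.sub_transpose_mul_self (M : SO3) :
    ((M : Mat3) - (M : Mat3)ᵀ) * ((M : Mat3) - (M : Mat3)ᵀ)
      = ((M : Mat3).trace + 1) • ((M : Mat3) + (M : Mat3)ᵀ - (2 : ℝ) • (1 : Mat3)) := by
  have h1 := M.mul_self_eq
  have h2 := congrArg Matrix.transpose h1
  simp only [Matrix.transpose_mul, Matrix.transpose_add, Matrix.transpose_sub,
    Matrix.transpose_smul, Matrix.transpose_one, Matrix.transpose_transpose] at h2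
  rw [sub_mul, mul_sub, mul_sub, M.mul_transpose_self, M.transpose_mul_self, h1, h2]
  module

/-- The cosine of the rotation angle between `R` and `Q`. -/
noncomputable def cosAngle (R Q : Mat3) : ℝ := ((Rᵀ * Q).trace - 1) / 2

theorem cosAngle_comm (R Q : Mat3) : cosAngle R Q = cosAngle Q R := by
  unfold cosAngle
  rw [← Matrix.trace_transpose, Matrix.transpose_mul, Matrix.transpose_transpose]

theorem cosAngle_sq_le_one (R Q : SO3) : cosAngle R Q ^ 2 ≤ 1 := by
  have h := (SO3.rel R Q).sum_sq_sub_transpose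
  rw [SO3.coe_rel] at h
  unfold cosAngle
  nlinarith [sq_nonneg ((R.1ᵀ * Q.1) 2 1 - (R.1ᵀ * Q.1) 1 2),
    sq_nonneg ((R.1ᵀ * Q.1) 0 2 - (R.1ᵀ * Q.1) 2 0),
    sq_nonneg ((R.1ᵀ * Q.1) 1 0 - (R.1ᵀ * Q.1) 0 1)]

theorem cosAngle_le_one (R Q : SO3) : cosAngle R Q ≤ 1 :=
  (abs_le.1 ((sq_le_one_iff_abs_le_one _).1 (cosAngle_sq_le_one R Q))).2

theorem neg_one_le_cosAngle (R Q : SO3) : -1 ≤ cosAngle R Q :=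
  (abs_le.1 ((sq_le_one_iff_abs_le_one _).1 (cosAngle_sq_le_one R Q))).1

theorem cosAngle_self (R : SO3) : cosAngle R R = 1 := by
  unfold cosAngle
  rw [R.transpose_mul_self]; norm_num [Matrix.trace_fin_three]

/-- For a skew-symmetric `A`, the derivative of the trace in the direction `A` is controlled by the
rotation angle and the Riemannian norm of `A`. -/
theorem SO3.sq_trace_mul_le (M : SO3) {A : Mat3} (hA : Aᵀ = -A) :
    ((M : Mat3) * A).trace ^ 2 ≤ (4 - ((M : Mat3).trace - 1) ^ 2) * metric A A := by
  rw [← M.sum_sq_sub_transpose]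
  have e : ∀ i j, A j i = - A i j := fun i j => congrFun (congrFun hA i) j
  have e00 : A 0 0 = 0 := by linarith [e 0 0]
  have e11 : A 1 1 = 0 := by linarith [e 1 1]
  have e22 : A 2 2 = 0 := by linarith [e 2 2]
  simp only [metric, Matrix.trace_fin_three, Matrix.mul_apply, Fin.sum_univ_three,
    Matrix.transpose_apply, e 0 1, e 0 2, e 1 2, e00, e11, e22]
  generalize (M : Mat3) = M
  -- Cauchy–Schwarz for the axial vectors of M − Mᵀ and A, by Lagrange's identity: the hints are the
  -- squared components of their cross product.
  nlinarith [sq_nonneg ((M 2 1 - M 1 2) * A 0 2 + (M 0 2 - M 2 0) * A 1 2),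
    sq_nonneg ((M 2 1 - M 1 2) * A 0 1 - (M 1 0 - M 0 1) * A 1 2),
    sq_nonneg ((M 0 2 - M 2 0) * A 0 1 + (M 1 0 - M 0 1) * A 0 2)]

theorem metric_mul_left (R : SO3) (A B : Mat3) :
    metric ((R : Mat3) * A) ((R : Mat3) * B) = metric A B := by
  unfold metric
  rw [Matrix.transpose_mul, Matrix.mul_assoc, ← Matrix.mul_assoc (R : Mat3)ᵀ,
    R.transpose_mul_self, Matrix.one_mul]

/-! ### Calculus of matrix-valued curves. -/

theorem hasDerivWithinAt_mat_iff {f : ℝ → Mat3} {f' : Mat3} {s : Set ℝ} {t : ℝ} :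
    HasDerivWithinAt f f' s t ↔ ∀ i j, HasDerivWithinAt (fun u => f u i j) (f' i j) s t := by
  have h1 : HasDerivWithinAt f f' s t ↔ ∀ i, HasDerivWithinAt (fun u => f u i) (f' i) s t :=
    hasDerivWithinAt_pi (E' := fun _ : Fin 3 => Fin 3 → ℝ) (φ := f) (φ' := f')
  exact h1.trans <| forall_congr' fun i => hasDerivWithinAt_pi

theorem hasDerivAt_mat_iff {f : ℝ → Mat3} {f' : Mat3} {t : ℝ} :
    HasDerivAt f f' t ↔ ∀ i j, HasDerivAt (fun u => f u i j) (f' i j) t := by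
  have h1 : HasDerivAt f f' t ↔ ∀ i, HasDerivAt (fun u => f u i) (f' i) t :=
    hasDerivAt_pi (E' := fun _ : Fin 3 => Fin 3 → ℝ) (φ := f) (φ' := f')
  exact h1.trans <| forall_congr' fun i => hasDerivAt_pi

theorem hasDerivWithinAt_mat_mul {f g : ℝ → Mat3} {f' g' : Mat3} {s : Set ℝ} {t : ℝ}
    (hf : HasDerivWithinAt f f' s t) (hg : HasDerivWithinAt g g' s t) :
    HasDerivWithinAt (fun u => f u * g u) (f' * g t + f t * g') s t := by
  rw [hasDerivWithinAt_mat_iff] at *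
  intro i j
  simp only [Matrix.mul_apply, Matrix.add_apply, ← Finset.sum_add_distrib]
  exact HasDerivWithinAt.fun_sum fun k _ => (hf i k).mul (hg k j)

theorem hasDerivWithinAt_mat_transpose {f : ℝ → Mat3} {f' : Mat3} {s : Set ℝ} {t : ℝ}
    (hf : HasDerivWithinAt f f' s t) :
    HasDerivWithinAt (fun u => (f u)ᵀ) f'ᵀ s t := by
  rw [hasDerivWithinAt_mat_iff] at *
  exact fun i j => hf j i

theorem hasDerivWithinAt_mat_trace {f : ℝ → Mat3} {f' : Mat3} {s : Set ℝ} {t : ℝ}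
    (hf : HasDerivWithinAt f f' s t) :
    HasDerivWithinAt (fun u => (f u).trace) f'.trace s t := by
  rw [hasDerivWithinAt_mat_iff] at hf
  simp only [Matrix.trace_fin_three]
  exact ((hf 0 0).add (hf 1 1)).add (hf 2 2)

/-- The velocity of a curve in `SO(3)` is a tangent vector. -/
theorem exists_skew_of_hasDerivAt {γ : ℝ → SO3} {W : Mat3} {t : ℝ}
    (h : HasDerivAt (fun s => (γ s : Mat3)) W t) :
    ∃ A : Mat3, Aᵀ = -A ∧ W = (γ t : Mat3) * A := by
  refine ⟨(γ t : Mat3)ᵀ * W, ?_, ?_⟩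
  · have h0 : HasDerivWithinAt (fun s => (γ s : Mat3)) W univ t := h.hasDerivWithinAt
    have h1 := hasDerivWithinAt_mat_mul (hasDerivWithinAt_mat_transpose h0) h0
    simp only [SO3.transpose_mul_self] at h1
    have h2 := (hasDerivWithinAt_univ.1 h1).unique (hasDerivAt_const t (1 : Mat3))
    rw [Matrix.transpose_mul, Matrix.transpose_transpose]
    exact eq_neg_of_add_eq_zero_left h2
  · rw [← Matrix.mul_assoc, SO3.mul_transpose_self, Matrix.one_mul]

theorem hasDerivWithinAt_cosAngle {f : ℝ → Mat3} {f' : Mat3} {s : Set ℝ} {t : ℝ} (Q : Mat3)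
    (hf : HasDerivWithinAt f f' s t) :
    HasDerivWithinAt (fun u => cosAngle Q (f u)) ((Qᵀ * f').trace / 2) s t := by
  have h := hasDerivWithinAt_mat_trace
    (hasDerivWithinAt_mat_mul (hasDerivWithinAt_const t s Qᵀ) hf)
  simp only [Matrix.zero_mul, zero_add] at h
  exact (h.sub_const 1).div_const 2

/-! ### The rotation angle as a lower bound for path length. -/

theorem metric_self_nonneg (V : Mat3) : 0 ≤ metric V V := by
  simp only [metric, Matrix.trace_fin_three, Matrix.mul_apply, Fin.sum_univ_three,
    Matrix.transpose_apply]
  nlinarith [mul_self_nonneg (V 0 0), mul_self_nonneg (V 0 1), mul_self_nonneg (V 0 2),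
    mul_self_nonneg (V 1 0), mul_self_nonneg (V 1 1), mul_self_nonneg (V 1 2),
    mul_self_nonneg (V 2 0), mul_self_nonneg (V 2 1), mul_self_nonneg (V 2 2)]

theorem continuous_metric_self : Continuous fun V : Mat3 => metric V V := by
  unfold metric
  fun_prop

theorem pathLength_nonneg (γ' : ℝ → Mat3) : 0 ≤ pathLength γ' :=
  intervalIntegral.integral_nonneg zero_le_one fun _ _ => Real.sqrt_nonneg _

/-- Infinitesimally, |d cos θ| ≤ sin θ times the speed, so θ changes at most at unit rate. -/
theorem abs_deriv_cosAngle_le (Q R : SO3) {A : Mat3} (hA : Aᵀ = -A) :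
    |((Q : Mat3)ᵀ * ((R : Mat3) * A)).trace / 2|
      ≤ √(1 - cosAngle Q R ^ 2) * √(metric ((R : Mat3) * A) ((R : Mat3) * A)) := by
  have h := (SO3.rel Q R).sq_trace_mul_le hA
  rw [metric_mul_left, ← Real.sqrt_mul (by linarith [cosAngle_sq_le_one Q R])]
  apply Real.abs_le_sqrt
  rw [← Matrix.mul_assoc]
  rw [SO3.coe_rel] at h
  unfold cosAngle
  linarith

/-- The rotation angle to a fixed rotation is `1`-Lipschitz along `C¹` paths. -/
theorem arccos_cosAngle_sub_le_pathLength (Q : SO3) {R P : SO3} {γ : ℝ → SO3} {γ' : ℝ → Mat3}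
    (h : IsC1Path γ γ' R P) :
    Real.arccos (cosAngle Q P) - Real.arccos (cosAngle Q R) ≤ pathLength γ' := by
  obtain ⟨h0, h1, hc, hd⟩ := h
  -- `arccos` is not differentiable at ±1; shrinking the cosine by 1 − δ avoids these values, and δ
  -- → 0 at the end.
  have key : ∀ δ : ℝ, 0 < δ → δ < 1 →
      Real.arccos ((1 - δ) * cosAngle Q P) - Real.arccos ((1 - δ) * cosAngle Q R)
        ≤ pathLength γ' := by
    intro δ hδ hδ1
    have hcont : ContinuousOn (fun t => cosAngle (Q : Mat3) (γ t)) (Icc 0 1) := fun t ht =>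
      (hasDerivWithinAt_cosAngle (Q : Mat3) (hd t ht)).continuousWithinAt
    have hint : IntegrableOn (fun t => √(metric (γ' t) (γ' t))) (Icc (0 : ℝ) 1) :=
      (Real.continuous_sqrt.comp_continuousOn
        (continuous_metric_self.comp_continuousOn hc)).integrableOn_Icc
    have := intervalIntegral.sub_le_integral_of_hasDeriv_right_of_le (a := 0) (b := 1)
      (g := fun t => Real.arccos ((1 - δ) * cosAngle (Q : Mat3) (γ t)))
      (g' := fun t => -(1 / √(1 - ((1 - δ) * cosAngle (Q : Mat3) (γ t)) ^ 2)) *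
        ((1 - δ) * (((Q : Mat3)ᵀ * γ' t).trace / 2)))
      (φ := fun t => √(metric (γ' t) (γ' t))) zero_le_one
      (Real.continuous_arccos.comp_continuousOn (hcont.const_mul _)) ?_ hint ?_
    · simpa only [h0, h1, pathLength] using this
    · intro t ht
      have hD := (hd t (Ioo_subset_Icc_self ht)).hasDerivAt (Icc_mem_nhds ht.1 ht.2)
      have hC := hasDerivWithinAt_cosAngle (Q : Mat3) hD.hasDerivWithinAt (s := Ioi t)
      have hb := abs_le.1 ((sq_le_one_iff_abs_le_one _).1 (cosAngle_sq_le_one Q (γ t)))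
      refine HasDerivAt.comp_hasDerivWithinAt (h₂ := Real.arccos) t
        (Real.hasDerivAt_arccos ?_ ?_) (hC.const_mul _)
      · nlinarith
      · nlinarith
    · intro t ht
      have hD := (hd t (Ioo_subset_Icc_self ht)).hasDerivAt (Icc_mem_nhds ht.1 ht.2)
      obtain ⟨A, hA, hW⟩ := exists_skew_of_hasDerivAt hD
      have hb := abs_deriv_cosAngle_le Q (γ t) hA
      rw [← hW] at hb
      have hsq := cosAngle_sq_le_one Q (γ t)
      set c := cosAngle (Q : Mat3) (γ t)
      set x := ((Q : Mat3)ᵀ * γ' t).trace / 2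
      set l := √(metric (γ' t) (γ' t))
      have hl : 0 ≤ l := Real.sqrt_nonneg _
      have hpos : 0 < √(1 - ((1 - δ) * c) ^ 2) := Real.sqrt_pos.2 (by
        have : (1 - δ) ^ 2 < 1 := by nlinarith
        rw [mul_pow]; nlinarith [sq_nonneg (1 - δ)])
      -- This comparison keeps the Lipschitz constant equal to 1 for every δ.
      have hmono : (1 - δ) * √(1 - c ^ 2) ≤ √(1 - ((1 - δ) * c) ^ 2) := by
        apply Real.le_sqrt_of_sq_le
        rw [mul_pow, Real.sq_sqrt (by linarith)]
        nlinarith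
      change -(1 / √(1 - ((1 - δ) * c) ^ 2)) * ((1 - δ) * x) ≤ l
      rw [neg_mul, ← mul_neg, one_div, inv_mul_le_iff₀ hpos]
      calc -((1 - δ) * x) ≤ (1 - δ) * |x| := by nlinarith [neg_abs_le x]
        _ ≤ (1 - δ) * (√(1 - c ^ 2) * l) := by gcongr
        _ = ((1 - δ) * √(1 - c ^ 2)) * l := by ring
        _ ≤ _ := by gcongr
  have hlim : Filter.Tendsto (fun δ : ℝ => Real.arccos ((1 - δ) * cosAngle Q P)
      - Real.arccos ((1 - δ) * cosAngle Q R)) (𝓝[>] 0)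
      (𝓝 (Real.arccos (cosAngle Q P) - Real.arccos (cosAngle Q R))) := by
    have : Continuous (fun δ : ℝ => Real.arccos ((1 - δ) * cosAngle (Q : Mat3) P)
      - Real.arccos ((1 - δ) * cosAngle (Q : Mat3) R)) := by
      have := Real.continuous_arccos
      fun_prop
    have h2 := (this.tendsto 0).mono_left (nhdsWithin_le_nhds (s := Ioi 0))
    simpa using h2
  refine le_of_tendsto hlim ?_
  filter_upwards [Ioo_mem_nhdsGT (zero_lt_one' ℝ)] with δ hδ using key δ hδ.1 hδ.2

/-! ### Rodrigues geodesics and the Riemannian distance. -/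

theorem skew_mul_self_mul_self {A : Mat3} (hA : Aᵀ = -A) :
    A * A * A = -(metric A A) • A := by
  have e : ∀ i j, A j i = - A i j := fun i j => congrFun (congrFun hA i) j
  have e00 : A 0 0 = 0 := by linarith [e 0 0]
  have e11 : A 1 1 = 0 := by linarith [e 1 1]
  have e22 : A 2 2 = 0 := by linarith [e 2 2]
  ext i j
  fin_cases i <;> fin_cases j <;>
    simp [metric, Matrix.trace_fin_three, Matrix.mul_apply, Fin.sum_univ_three,
      e 0 1, e 0 2, e 1 2, e00, e11, e22] <;> ring

/-- The Rodrigues curve `s ↦ 1 + sin s • A + (1 - cos s) • A²`. -/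
noncomputable def rodrigues (A : Mat3) (s : ℝ) : Mat3 :=
  1 + Real.sin s • A + (1 - Real.cos s) • (A * A)

theorem rodrigues_mul_transpose {A : Mat3} (hA : Aᵀ = -A) (h1 : metric A A = 1) (s : ℝ) :
    rodrigues A s * (rodrigues A s)ᵀ = 1 := by
  have h3 := skew_mul_self_mul_self hA
  rw [h1, neg_one_smul] at h3
  have h4 : A * A * (A * A) = -(A * A) := by rw [← mul_assoc, h3, neg_mul]
  have h5 : A * (A * A) = -A := by rw [← mul_assoc, h3]
  have hT : (rodrigues A s)ᵀ = 1 - Real.sin s • A + (1 - Real.cos s) • (A * A) := by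
    simp only [rodrigues, Matrix.transpose_add, Matrix.transpose_one, Matrix.transpose_smul,
      Matrix.transpose_mul, hA]
    rw [neg_mul_neg, smul_neg, ← sub_eq_add_neg]
  rw [hT, rodrigues]
  simp only [add_mul, mul_add, mul_sub, one_mul, mul_one, smul_mul_assoc, mul_smul_comm, h3, h4, h5]
  have hs := Real.sin_sq_add_cos_sq s
  match_scalars
  · ring
  · ring
  · linear_combination (-1 : ℝ) * hs

theorem rodrigues_det {A : Mat3} (hA : Aᵀ = -A) (h1 : metric A A = 1) (s : ℝ) :
    (rodrigues A s).det = 1 := by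
  have e : ∀ i j, A j i = - A i j := fun i j => congrFun (congrFun hA i) j
  have e00 : A 0 0 = 0 := by linarith [e 0 0]
  have e11 : A 1 1 = 0 := by linarith [e 1 1]
  have e22 : A 2 2 = 0 := by linarith [e 2 2]
  have hs := Real.sin_sq_add_cos_sq s
  simp [metric, Matrix.trace_fin_three, Matrix.mul_apply, Fin.sum_univ_three,
      e 0 1, e 0 2, e 1 2, e00, e11, e22] at h1
  have hn : A 0 1 ^ 2 + A 0 2 ^ 2 + A 1 2 ^ 2 = 1 := by linarith
  -- With n = |A|², the eigenvalues are 1 and 1 − (1 − cos s) n ± i sin s √n.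
  have hdet : (rodrigues A s).det =
      (1 - (1 - Real.cos s) * (A 0 1 ^ 2 + A 0 2 ^ 2 + A 1 2 ^ 2)) ^ 2
        + Real.sin s ^ 2 * (A 0 1 ^ 2 + A 0 2 ^ 2 + A 1 2 ^ 2) := by
    simp [rodrigues, Matrix.det_fin_three, Matrix.mul_apply, Fin.sum_univ_three,
      e 0 1, e 0 2, e 1 2, e00, e11, e22]
    ring
  rw [hdet, hn]
  linarith

theorem hasDerivAt_rodrigues (A : Mat3) (s : ℝ) :
    HasDerivAt (rodrigues A) (Real.cos s • A + Real.sin s • (A * A)) s := by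
  rw [hasDerivAt_mat_iff]
  intro i j
  have h1 := ((Real.hasDerivAt_sin s).mul_const (A i j)).const_add ((1 : Mat3) i j)
  have h2 := ((Real.hasDerivAt_cos s).const_sub 1).mul_const ((A * A) i j)
  have h3 := h1.add h2
  rw [neg_neg] at h3
  exact h3

/-- The geodesic in `SO(3)` with unit velocity `R A` at `s = 0`. -/
noncomputable def geodesic (R : SO3) {A : Mat3} (hA : Aᵀ = -A) (h1 : metric A A = 1) (s : ℝ) :
    SO3 :=
  R * ⟨rodrigues A s, mem_SO3_of (rodrigues_mul_transpose hA h1 s) (rodrigues_det hA h1 s)⟩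

theorem hasDerivAt_geodesic (R : SO3) {A : Mat3} (hA : Aᵀ = -A) (h1 : metric A A = 1) (s : ℝ) :
    HasDerivAt (fun u => (geodesic R hA h1 u : Mat3))
      ((geodesic R hA h1 s : Mat3) * A) s := by
  have h : HasDerivWithinAt (fun u => (R : Mat3) * rodrigues A u)
      (0 * rodrigues A s + (R : Mat3) * (Real.cos s • A + Real.sin s • (A * A))) univ s :=
    hasDerivWithinAt_mat_mul (hasDerivWithinAt_const s univ (R : Mat3))
      (hasDerivAt_rodrigues A s).hasDerivWithinAt
  have e : 0 * rodrigues A s + (R : Mat3) * (Real.cos s • A + Real.sin s • (A * A))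
      = (R : Mat3) * rodrigues A s * A := by
    have h3 := skew_mul_self_mul_self hA
    rw [h1, neg_one_smul] at h3
    rw [zero_mul, zero_add, mul_assoc, rodrigues]
    congr 1
    simp only [add_mul, one_mul, smul_mul_assoc, h3]
    module
  rw [e] at h
  exact hasDerivWithinAt_univ.1 h

theorem geodesic_zero (R : SO3) {A : Mat3} (hA : Aᵀ = -A) (h1 : metric A A = 1) :
    geodesic R hA h1 0 = R := by
  apply Subtype.ext
  simp [geodesic, rodrigues]

theorem metric_smul_smul (a b : ℝ) (V W : Mat3) :
    metric (a • V) (b • W) = a * b * metric V W := by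
  simp only [metric, Matrix.transpose_smul, smul_mul_assoc, mul_smul_comm, Matrix.trace_smul,
    smul_eq_mul]
  ring

theorem hasDerivAt_mat_comp_mul {f : ℝ → Mat3} {V : Mat3} {a t : ℝ}
    (h : HasDerivAt f V (a * t)) : HasDerivAt (fun s => f (a * s)) (a • V) t := by
  rw [hasDerivAt_mat_iff] at *
  intro i j
  have := (h i j).comp t ((hasDerivAt_id t).const_mul a)
  simp only [mul_one] at this
  rw [mul_comm] at this
  exact this

theorem bddBelow_pathLength (R Q : SO3) :
    BddBelow {l : ℝ | ∃ (γ : ℝ → SO3) (γ' : ℝ → Mat3), IsC1Path γ γ' R Q ∧ l = pathLength γ'} :=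
  ⟨0, by rintro _ ⟨γ, γ', -, rfl⟩; exact pathLength_nonneg γ'⟩

theorem isC1Path_geodesic (R : SO3) {A : Mat3} (hA : Aᵀ = -A) (h1 : metric A A = 1) (θ : ℝ) :
    IsC1Path (fun t => geodesic R hA h1 (θ * t))
      (fun t => θ • ((geodesic R hA h1 (θ * t) : Mat3) * A)) R (geodesic R hA h1 θ) := by
  have hd : ∀ t, HasDerivAt (fun s => (geodesic R hA h1 (θ * s) : Mat3))
      (θ • ((geodesic R hA h1 (θ * t) : Mat3) * A)) t := fun t =>
    hasDerivAt_mat_comp_mul (hasDerivAt_geodesic R hA h1 (θ * t))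
  refine ⟨by simp [geodesic_zero], by simp, ?_, fun t _ => (hd t).hasDerivWithinAt⟩
  have hc : Continuous (fun s => (geodesic R hA h1 (θ * s) : Mat3)) :=
    continuous_iff_continuousAt.2 fun t => (hd t).continuousAt
  exact ((hc.matrix_mul continuous_const).const_smul θ).continuousOn

theorem riemannianDist_geodesic_le (R : SO3) {A : Mat3} (hA : Aᵀ = -A) (h1 : metric A A = 1)
    {θ : ℝ} (hθ : 0 ≤ θ) : riemannianDist R (geodesic R hA h1 θ) ≤ θ := by
  refine csInf_le (bddBelow_pathLength _ _) ⟨_, _, isC1Path_geodesic R hA h1 θ, ?_⟩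
  simp only [pathLength, metric_smul_smul, metric_mul_left, h1, mul_one, Real.sqrt_mul_self hθ]
  simp

theorem riemannianDist_self (R : SO3) : riemannianDist R R = 0 := by
  refine le_antisymm (csInf_le (bddBelow_pathLength _ _) ⟨fun _ => R, fun _ => 0,
    ⟨rfl, rfl, continuousOn_const, fun t _ => hasDerivWithinAt_const _ _ _⟩, ?_⟩)
    (Real.sInf_nonneg ?_)
  · simp [pathLength, metric]
  · rintro _ ⟨γ, γ', -, rfl⟩; exact pathLength_nonneg γ'

/-- For M = RᵀQ, trace 3 makes the sum of squares of the skew part vanish, so M is symmetric; the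
formula for (M − Mᵀ)² then reads 0 = 8(M − 1). -/
theorem eq_of_cosAngle_eq_one {R Q : SO3} (h : cosAngle R Q = 1) : R = Q := by
  have h3 : (SO3.rel R Q : Mat3).trace = 3 := by
    unfold cosAngle at h; rw [SO3.coe_rel]; linarith
  have h1 := (SO3.rel R Q).sum_sq_sub_transpose
  have h2 := (SO3.rel R Q).sub_transpose_mul_self
  rw [h3] at h1 h2
  have ha : (SO3.rel R Q : Mat3) 2 1 - (SO3.rel R Q : Mat3) 1 2 = 0 := by nlinarith
  have hb : (SO3.rel R Q : Mat3) 0 2 - (SO3.rel R Q : Mat3) 2 0 = 0 := by nlinarith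
  have hc : (SO3.rel R Q : Mat3) 1 0 - (SO3.rel R Q : Mat3) 0 1 = 0 := by nlinarith
  have hM : (SO3.rel R Q : Mat3) - (SO3.rel R Q : Mat3)ᵀ = 0 := by
    ext i j
    fin_cases i <;> fin_cases j <;>
      simp only [Matrix.sub_apply, Matrix.transpose_apply, Matrix.zero_apply, Fin.zero_eta,
        Fin.mk_one, Fin.reduceFinMk] <;> linarith
  rw [hM, zero_mul] at h2
  have h4 : (SO3.rel R Q : Mat3) = 1 := by
    rw [← sub_eq_zero.1 hM] at h2
    have h5 : (8 : ℝ) • ((SO3.rel R Q : Mat3) - 1) = 0 := by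
      rw [h2]; module
    exact sub_eq_zero.1 ((smul_eq_zero.1 h5).resolve_left (by norm_num))
  apply Subtype.ext
  calc (R : Mat3) = R * (SO3.rel R Q : Mat3) := by rw [h4, mul_one]
    _ = Q := by rw [SO3.coe_rel, ← mul_assoc, R.mul_transpose_self, one_mul]

theorem exists_geodesic {R Q : SO3} (h0 : -1 < cosAngle R Q) (h1 : cosAngle R Q < 1) :
    ∃ (A : Mat3) (hA : Aᵀ = -A) (hA1 : metric A A = 1),
      geodesic R hA hA1 (Real.arccos (cosAngle R Q)) = Q := by
  set c := cosAngle R Q with hc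
  set M := SO3.rel R Q with hM
  have htr : (M : Mat3).trace = 1 + 2 * c := by
    rw [hc, hM, SO3.coe_rel]; unfold cosAngle; ring
  set s := √(1 - c ^ 2) with hs
  have hs0 : 0 < 1 - c ^ 2 := by nlinarith
  have hspos : 0 < s := Real.sqrt_pos.2 hs0
  have hs2 : s ^ 2 = 1 - c ^ 2 := Real.sq_sqrt hs0.le
  have hB : ((M : Mat3) - (M : Mat3)ᵀ)ᵀ = -((M : Mat3) - (M : Mat3)ᵀ) := by
    simp [Matrix.transpose_sub]
  have hBB : metric ((M : Mat3) - (M : Mat3)ᵀ) ((M : Mat3) - (M : Mat3)ᵀ) = 4 * s ^ 2 := by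
    have := M.sum_sq_sub_transpose
    rw [htr] at this
    rw [hs2]
    simp only [metric, Matrix.trace_fin_three, Matrix.mul_apply, Fin.sum_univ_three,
      Matrix.transpose_apply, Matrix.sub_apply]
    linear_combination this
  -- Rodrigues' formula has skew part sin θ A, whence A = (M − Mᵀ)/(2 sin θ).
  refine ⟨(2 * s)⁻¹ • ((M : Mat3) - (M : Mat3)ᵀ), ?_, ?_, ?_⟩
  · rw [Matrix.transpose_smul, hB, smul_neg]
  · rw [metric_smul_smul, hBB]; field_simp; norm_num
  · apply Subtype.ext
    have hrod : rodrigues ((2 * s)⁻¹ • ((M : Mat3) - (M : Mat3)ᵀ)) (Real.arccos c) = M := by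
      rw [rodrigues, Real.sin_arccos, Real.cos_arccos h0.le h1.le, ← hs, smul_mul_smul_comm,
        M.sub_transpose_mul_self, htr]
      have hss : (2 * s)⁻¹ * (2 * s)⁻¹ = (4 * ((1 - c) * (1 + c)))⁻¹ := by
        rw [← mul_inv]; congr 1; linear_combination 4 * hs2
      rw [hss]
      have hc1 : 1 - c ≠ 0 := by linarith
      have hc2 : 1 + c ≠ 0 := by linarith
      match_scalars
      · field_simp; ring
      · field_simp; ring
      · field_simp; ring
    change (R : Mat3) * rodrigues _ _ = Q
    rw [hrod, hM, SO3.coe_rel, ← mul_assoc, R.mul_transpose_self, one_mul]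

theorem exists_isC1Path_of_neg_one_lt {R Q : SO3} (h0 : -1 < cosAngle R Q) :
    ∃ γ γ', IsC1Path γ γ' R Q := by
  rcases (cosAngle_le_one R Q).lt_or_eq with h1 | h1
  · obtain ⟨A, hA, hA1, h⟩ := exists_geodesic h0 h1
    have := isC1Path_geodesic R hA hA1 (Real.arccos (cosAngle R Q))
    rw [h] at this
    exact ⟨_, _, this⟩
  · rw [eq_of_cosAngle_eq_one h1]
    exact ⟨fun _ => Q, fun _ => 0, rfl, rfl, continuousOn_const,
      fun t _ => hasDerivWithinAt_const _ _ _⟩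

theorem IsC1Path.mul {γ₁ γ₂ : ℝ → SO3} {γ₁' γ₂' : ℝ → Mat3} {R₁ Q₁ R₂ Q₂ : SO3}
    (h₁ : IsC1Path γ₁ γ₁' R₁ Q₁) (h₂ : IsC1Path γ₂ γ₂' R₂ Q₂) :
    IsC1Path (fun t => γ₁ t * γ₂ t)
      (fun t => γ₁' t * (γ₂ t : Mat3) + (γ₁ t : Mat3) * γ₂' t) (R₁ * R₂) (Q₁ * Q₂) := by
  obtain ⟨a₁, b₁, c₁, d₁⟩ := h₁
  obtain ⟨a₂, b₂, c₂, d₂⟩ := h₂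
  have e₁ : ContinuousOn (fun t => (γ₁ t : Mat3)) (Icc 0 1) :=
    fun t ht => (d₁ t ht).continuousWithinAt
  have e₂ : ContinuousOn (fun t => (γ₂ t : Mat3)) (Icc 0 1) :=
    fun t ht => (d₂ t ht).continuousWithinAt
  refine ⟨by simp only [a₁, a₂], by simp only [b₁, b₂], ?_,
    fun t ht => hasDerivWithinAt_mat_mul (d₁ t ht) (d₂ t ht)⟩
  have hm : Continuous fun p : Mat3 × Mat3 => p.1 * p.2 := by fun_prop
  exact (hm.comp_continuousOn (c₁.prodMk e₂)).add (hm.comp_continuousOn (e₁.prodMk c₂))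

/-- One of the half-turns about the coordinate axes works: if all three products had trace −1,
adding them would give −tr M = −3, against tr M = −1. -/
theorem exists_skew_trace_ne (M : Mat3) (h : M.trace = -1) :
    ∃ A : Mat3, Aᵀ = -A ∧ metric A A = 1 ∧ (M * rodrigues A (-Real.pi)).trace ≠ -1 := by
  by_contra! hcon
  have h1 := hcon !![0, 0, 0; 0, 0, 1; 0, -1, 0] (by ext i j; fin_cases i <;> fin_cases j <;> simp)
    (by simp [metric, Matrix.trace_fin_three, Matrix.mul_apply, Fin.sum_univ_three]; norm_num)
  have h2 := hcon !![0, 0, 1; 0, 0, 0; -1, 0, 0] (by ext i j; fin_cases i <;> fin_cases j <;> simp)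
    (by simp [metric, Matrix.trace_fin_three, Matrix.mul_apply, Fin.sum_univ_three]; norm_num)
  have h3 := hcon !![0, 1, 0; -1, 0, 0; 0, 0, 0] (by ext i j; fin_cases i <;> fin_cases j <;> simp)
    (by simp [metric, Matrix.trace_fin_three, Matrix.mul_apply, Fin.sum_univ_three]; norm_num)
  simp [rodrigues, Matrix.trace_fin_three, Matrix.mul_apply, Fin.sum_univ_three] at h h1 h2 h3
  linarith

/-- The set of lengths defining the distance must be nonempty, since `sInf ∅ = 0` would destroy the
lower bound. At a cut point, Q is first moved off the cut locus by a half-turn N. -/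
theorem exists_isC1Path (R Q : SO3) : ∃ γ γ', IsC1Path γ γ' R Q := by
  rcases (neg_one_le_cosAngle R Q).lt_or_eq with h | h
  · exact exists_isC1Path_of_neg_one_lt h
  obtain ⟨A, hA, hA1, hne⟩ := exists_skew_trace_ne (SO3.rel R Q : Mat3) (by
    rw [SO3.coe_rel]; unfold cosAngle at h; linarith)
  have h1 := isC1Path_geodesic 1 hA hA1 (-Real.pi)
  have h1' := isC1Path_geodesic 1 hA hA1 Real.pi
  set N := geodesic 1 hA hA1 (-Real.pi) with hN
  have hNN : N * geodesic 1 hA hA1 Real.pi = 1 := by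
    have e := rodrigues_mul_transpose hA hA1 Real.pi
    have e2 : (rodrigues A Real.pi)ᵀ = rodrigues A Real.pi := by
      simp [rodrigues, Matrix.transpose_mul, hA]
    have e3 : rodrigues A (-Real.pi) = rodrigues A Real.pi := by simp [rodrigues]
    rw [e2] at e
    apply Subtype.ext
    simp only [hN, geodesic, one_mul]
    change rodrigues A (-Real.pi) * rodrigues A Real.pi = 1
    rw [e3, e]
  have h2 : -1 < cosAngle R ((Q * N : SO3) : Mat3) := by
    refine (neg_one_le_cosAngle R (Q * N)).lt_of_ne fun h' => hne ?_
    have e : ((Q * N : SO3) : Mat3) = (Q : Mat3) * rodrigues A (-Real.pi) := by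
      simp [hN, geodesic]
    rw [e] at h'
    unfold cosAngle at h'
    rw [SO3.coe_rel, mul_assoc]
    linarith
  obtain ⟨γ, γ', hγ⟩ := exists_isC1Path_of_neg_one_lt h2
  -- The path from R to QN is multiplied pointwise by one from 1 to N⁻¹; unlike a concatenation, the
  -- product has no corner.
  have h3 := hγ.mul h1'
  rw [mul_one, mul_assoc, hNN, mul_one] at h3
  exact ⟨_, _, h3⟩

theorem riemannianDist_le_arccos {R Q : SO3} (h0 : -1 < cosAngle R Q) :
    riemannianDist R Q ≤ Real.arccos (cosAngle R Q) := by
  rcases (cosAngle_le_one R Q).lt_or_eq with h1 | h1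
  · obtain ⟨A, hA, hA1, h⟩ := exists_geodesic h0 h1
    have := riemannianDist_geodesic_le R hA hA1 (Real.arccos_nonneg (cosAngle R Q))
    rwa [h] at this
  · rw [h1, Real.arccos_one, eq_of_cosAngle_eq_one h1, riemannianDist_self]

/-- The rotation angle to a fixed rotation is `1`-Lipschitz for the Riemannian distance. -/
theorem arccos_cosAngle_le_add (Q R P : SO3) :
    Real.arccos (cosAngle Q P) ≤ Real.arccos (cosAngle Q R) + riemannianDist R P := by
  rw [← sub_le_iff_le_add']
  obtain ⟨γ, γ', h⟩ := exists_isC1Path R P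
  refine le_csInf ⟨_, γ, γ', h, rfl⟩ ?_
  rintro _ ⟨γ, γ', h, rfl⟩
  exact arccos_cosAngle_sub_le_pathLength Q h

theorem arccos_cosAngle_le (R P : SO3) : Real.arccos (cosAngle R P) ≤ riemannianDist R P := by
  simpa [cosAngle_self] using arccos_cosAngle_le_add R R P

/-- Off the cut locus, the Riemannian distance is the rotation angle. -/
theorem riemannianDist_eq_arccos {R Q : SO3} (h0 : -1 < cosAngle R Q) :
    riemannianDist R Q = Real.arccos (cosAngle R Q) :=
  le_antisymm (riemannianDist_le_arccos h0) (arccos_cosAngle_le R Q)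

/-- Expresses the disk by an open condition on matrices. Cut points need no separate care: cos r ≥
−1, so the strict inequality excludes them. -/
theorem mem_geodesicDisk_iff {r : ℝ} (hr0 : 0 < r) (hr : r ≤ Real.pi) (R : SO3) :
    R ∈ geodesicDisk r ↔ Real.cos r < cosAngle (1 : Mat3) R := by
  have key : Real.arccos (cosAngle (1 : Mat3) R) < r ↔ Real.cos r < cosAngle (1 : Mat3) R := by
    have h1 := cosAngle_le_one 1 R
    have h2 := neg_one_le_cosAngle 1 R
    rw [OneMemClass.coe_one] at h1 h2
    conv_rhs => rw [← Real.cos_arccos h2 h1]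
    exact (Real.strictAntiOn_cos.lt_iff_gt ⟨hr0.le, hr⟩
      ⟨Real.arccos_nonneg _, Real.arccos_le_pi _⟩).symm
  constructor
  · intro h
    exact key.1 ((arccos_cosAngle_le 1 R).trans_lt h)
  · intro h
    refine (riemannianDist_le_arccos (R := 1) ?_).trans_lt (key.2 h)
    exact (Real.neg_one_le_cos r).trans_lt h

/-- Triangle inequality for the angle through the centre 1; since 2r ≤ π, the cosine is decreasing
on the range involved. -/
theorem cos_two_mul_lt_cosAngle {r : ℝ} (hr : r ≤ Real.pi / 2) {R Q : SO3}
    (hR : R ∈ geodesicDisk r) (hQ : Q ∈ geodesicDisk r) :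
    Real.cos (2 * r) < cosAngle R Q := by
  have h1 := arccos_cosAngle_le_add R 1 Q
  have h2 := arccos_cosAngle_le 1 R
  rw [cosAngle_comm] at h2
  have h3 : riemannianDist 1 R < r := hR
  have h4 : riemannianDist 1 Q < r := hQ
  have h5 := Real.arccos_nonneg (cosAngle R Q)
  rw [← Real.cos_arccos (neg_one_le_cosAngle R Q) (cosAngle_le_one R Q)]
  exact Real.cos_lt_cos_of_nonneg_of_le_pi h5 (by linarith) (by linarith)

/-! ### Regularity of θ/sin θ and θ² as functions of cos θ. -/

/-- The function `cos θ ↦ θ / sin θ`. -/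
noncomputable def angleDivSin (c : ℝ) : ℝ := (Real.sinc (Real.arccos c))⁻¹

theorem sinc_arccos_pos {c : ℝ} (h0 : -1 < c) : 0 < Real.sinc (Real.arccos c) := by
  rcases (Real.arccos_nonneg c).lt_or_eq with h | h
  · rw [Real.sinc_of_ne_zero h.ne']
    refine div_pos (Real.sin_pos_of_pos_of_lt_pi h ?_) h
    exact (Real.arccos_le_pi c).lt_of_ne fun e => absurd (Real.arccos_eq_pi.1 e) (by linarith)
  · rw [← h]; simp

theorem continuousOn_angleDivSin : ContinuousOn angleDivSin (Ioi (-1)) := by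
  refine ContinuousOn.inv₀ ?_ fun c hc => (sinc_arccos_pos hc).ne'
  exact (Real.continuous_sinc.comp Real.continuous_arccos).continuousOn

theorem angleDivSin_eq {c : ℝ} (h1 : c < 1) :
    angleDivSin c = Real.arccos c / √(1 - c ^ 2) := by
  have h : Real.arccos c ≠ 0 := (Real.arccos_pos.2 h1).ne'
  rw [angleDivSin, Real.sinc_of_ne_zero h, inv_div, Real.sin_arccos]

theorem angleDivSin_pos {c : ℝ} (h0 : -1 < c) : 0 < angleDivSin c := inv_pos.2 (sinc_arccos_pos h0)

theorem hasDerivAt_angleDivSin {c : ℝ} (h0 : -1 < c) (h1 : c < 1) :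
    HasDerivAt angleDivSin ((c * angleDivSin c - 1) / (1 - c ^ 2)) c := by
  have hpos : 0 < 1 - c ^ 2 := by nlinarith
  have hd : HasDerivAt (fun c => Real.arccos c / √(1 - c ^ 2))
      ((-(1 / √(1 - c ^ 2)) * √(1 - c ^ 2) - Real.arccos c * (-(2 * c) / (2 * √(1 - c ^ 2))))
        / √(1 - c ^ 2) ^ 2) c := by
    have h2 : HasDerivAt (fun c : ℝ => 1 - c ^ 2) (-(2 * c)) c := by
      simpa using (hasDerivAt_pow 2 c).const_sub 1
    exact (Real.hasDerivAt_arccos h0.ne' h1.ne).div (h2.sqrt hpos.ne') (Real.sqrt_pos.2 hpos).ne'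
  have he : angleDivSin =ᶠ[𝓝 c] fun c => Real.arccos c / √(1 - c ^ 2) := by
    filter_upwards [Iio_mem_nhds h1] with x hx using angleDivSin_eq hx
  refine (hd.congr_of_eventuallyEq he).congr_deriv ?_
  rw [angleDivSin_eq h1, Real.sq_sqrt hpos.le]
  have := (Real.sqrt_pos.2 hpos).ne'
  field_simp
  ring

/-- The derivative of θ/sin θ with respect to cos θ is −(sin θ − θ cos θ)/sin³ θ; the cubic bound
compensates the denominator as θ → 0. -/
theorem sin_sub_mul_cos_bounds {θ : ℝ} (h0 : 0 ≤ θ) (h1 : θ ≤ Real.pi) :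
    0 ≤ Real.sin θ - θ * Real.cos θ ∧ Real.sin θ - θ * Real.cos θ ≤ θ ^ 3 / 2 := by
  constructor
  · rcases lt_or_ge θ (Real.pi / 2) with h | h
    · have h2 := Real.le_tan h0 h
      have hc := Real.cos_pos_of_mem_Ioo ⟨by linarith, h⟩
      rw [Real.tan_eq_sin_div_cos, le_div_iff₀ hc] at h2
      linarith
    · have hc := Real.cos_nonpos_of_pi_div_two_le_of_le h (by linarith)
      have hs := Real.sin_nonneg_of_nonneg_of_le_pi h0 h1
      nlinarith
  · have h2 := Real.sin_le h0
    have h3 := Real.one_sub_sq_div_two_le_cos (x := θ)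
    nlinarith

theorem deriv_angleDivSin_bounds {c : ℝ} (h0 : -1 < c) (h1 : c < 1) :
    -(angleDivSin c ^ 3 / 2) ≤ (c * angleDivSin c - 1) / (1 - c ^ 2) ∧
      (c * angleDivSin c - 1) / (1 - c ^ 2) ≤ 0 := by
  have hpos : 0 < 1 - c ^ 2 := by nlinarith
  have hs : 0 < √(1 - c ^ 2) := Real.sqrt_pos.2 hpos
  have hb := sin_sub_mul_cos_bounds (Real.arccos_nonneg c) (Real.arccos_le_pi c)
  rw [Real.sin_arccos, Real.cos_arccos h0.le h1.le] at hb
  have e : (c * angleDivSin c - 1) / (1 - c ^ 2)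
      = -(√(1 - c ^ 2) - Real.arccos c * c) / √(1 - c ^ 2) ^ 3 := by
    have h2 : 1 - c ^ 2 = √(1 - c ^ 2) ^ 2 := (Real.sq_sqrt hpos.le).symm
    rw [angleDivSin_eq h1]
    generalize √(1 - c ^ 2) = s at *
    rw [h2]
    field_simp
    ring
  rw [e, angleDivSin_eq h1, div_pow, neg_div]
  generalize √(1 - c ^ 2) = s at *
  constructor
  · rw [neg_le_neg_iff, div_right_comm]
    gcongr
    exact hb.2
  · rw [neg_nonpos]
    exact div_nonneg hb.1 (by positivity)

theorem antitoneOn_angleDivSin {c₀ : ℝ} (h0 : -1 < c₀) : AntitoneOn angleDivSin (Icc c₀ 1) := by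
  refine antitoneOn_of_deriv_nonpos (convex_Icc _ _)
    (continuousOn_angleDivSin.mono fun c hc => h0.trans_le hc.1) ?_ ?_ <;>
    rw [interior_Icc] <;> intro c hc
  · exact (hasDerivAt_angleDivSin (h0.trans hc.1) hc.2).differentiableAt.differentiableWithinAt
  · rw [(hasDerivAt_angleDivSin (h0.trans hc.1) hc.2).deriv]
    exact (deriv_angleDivSin_bounds (h0.trans hc.1) hc.2).2

theorem exists_lipschitzOnWith_angleDivSin {c₀ : ℝ} (h0 : -1 < c₀) :
    ∃ L : ℝ≥0, LipschitzOnWith L angleDivSin (Icc c₀ 1) := by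
  set C := angleDivSin c₀ ^ 3 / 2 with hC
  have hC0 : 0 ≤ C := by have := angleDivSin_pos h0; positivity
  refine ⟨C.toNNReal, LipschitzOnWith.of_le_add_mul' C fun x hx y hy => ?_⟩
  -- `angleDivSin` decreases, while its sum with C c increases; together they give the Lipschitz
  -- bound up to c = 1 with no derivative there.
  have hmono : MonotoneOn (fun c => angleDivSin c + C * c) (Icc c₀ 1) := by
    have hd : ∀ c ∈ Ioo c₀ 1, HasDerivAt (fun c => angleDivSin c + C * c)
        ((c * angleDivSin c - 1) / (1 - c ^ 2) + C) c := fun c hc => by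
      have := (hasDerivAt_angleDivSin (h0.trans hc.1) hc.2).add ((hasDerivAt_id c).const_mul C)
      rw [mul_one] at this
      exact this
    refine monotoneOn_of_deriv_nonneg (convex_Icc _ _)
      ((continuousOn_angleDivSin.mono fun c hc => h0.trans_le hc.1).add (by fun_prop)) ?_ ?_ <;>
      rw [interior_Icc] <;> intro c hc
    · exact (hd c hc).differentiableAt.differentiableWithinAt
    · rw [(hd c hc).deriv]
      have h1 := (deriv_angleDivSin_bounds (h0.trans hc.1) hc.2).1
      have h2 : angleDivSin c ^ 3 ≤ angleDivSin c₀ ^ 3 := by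
        have := (angleDivSin_pos (h0.trans hc.1)).le
        gcongr
        exact antitoneOn_angleDivSin h0 ⟨le_rfl, (hc.1.trans hc.2).le⟩ ⟨hc.1.le, hc.2.le⟩ hc.1.le
      linarith
  rw [Real.dist_eq]
  rcases le_total x y with h | h
  · have := hmono hx hy h
    simp only at this
    rw [abs_of_nonpos (by linarith)]
    linarith
  · have := antitoneOn_angleDivSin h0 hy hx h
    nlinarith [abs_nonneg (x - y)]

/-- `arccos²` is differentiable from the left up to `1`. -/
theorem hasDerivWithinAt_arccos_sq {c : ℝ} (h0 : -1 < c) (h1 : c ≤ 1) :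
    HasDerivWithinAt (fun c => Real.arccos c ^ 2) (-2 * angleDivSin c) (Iic 1) c := by
  have hd : ∀ x ∈ Ioo (-1 : ℝ) 1, HasDerivAt (fun c => Real.arccos c ^ 2)
      (-2 * angleDivSin x) x := by
    intro x hx
    refine ((Real.hasDerivAt_arccos hx.1.ne' hx.2.ne).pow 2).congr_deriv ?_
    rw [angleDivSin_eq hx.2]
    simp
    ring
  rcases h1.lt_or_eq with h | rfl
  · exact (hd c ⟨h0, h⟩).hasDerivWithinAt
  -- At c = 1 the one-sided derivative is the limit of the interior derivatives.
  · refine hasDerivWithinAt_Iic_of_tendsto_deriv (s := Ioo (-1) 1)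
      (fun x hx => (hd x hx).differentiableAt.differentiableWithinAt)
      ((Real.continuous_arccos.pow 2).continuousWithinAt) (Ioo_mem_nhdsLT (by norm_num)) ?_
    have hc : Filter.Tendsto (fun x => -2 * angleDivSin x) (𝓝[<] 1) (𝓝 (-2 * angleDivSin 1)) :=
      ((continuousOn_angleDivSin.continuousAt (Ioi_mem_nhds (by norm_num))).tendsto.const_mul
        _).mono_left nhdsWithin_le_nhds
    refine hc.congr' ?_
    filter_upwards [Ioo_mem_nhdsLT (show (-1 : ℝ) < 1 by norm_num)] with x hx
    exact (hd x hx).deriv.symm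

theorem exists_lipschitzOnWith_arccos_sq {c₀ : ℝ} (h0 : -1 < c₀) :
    ∃ L : ℝ≥0, LipschitzOnWith L (fun c => Real.arccos c ^ 2) (Icc c₀ 1) := by
  have hp := angleDivSin_pos h0
  refine ⟨(2 * angleDivSin c₀).toNNReal,
    (convex_Icc c₀ 1).lipschitzOnWith_of_nnnorm_hasDerivWithin_le
      (f' := fun c => -2 * angleDivSin c) (fun c hc =>
      (hasDerivWithinAt_arccos_sq (h0.trans_le hc.1) hc.2).mono Icc_subset_Iic_self) ?_⟩
  intro c hc
  rw [← NNReal.coe_le_coe, coe_nnnorm, Real.coe_toNNReal _ (by positivity),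
    Real.norm_eq_abs, abs_mul,
    abs_of_pos (angleDivSin_pos (h0.trans_le hc.1))]
  have := antitoneOn_angleDivSin h0 ⟨le_rfl, hc.1.trans hc.2⟩ hc hc.1
  norm_num
  exact this

/-! ### The interaction force and the gradient of the potential. -/

/-- The scalar factor `g'(θ²) θ / sin θ` of the interaction force, as a function of `cos θ`. -/
noncomputable def forceFactor (g : ℝ → ℝ) (c : ℝ) : ℝ :=
  derivWithin g (Ici 0) (Real.arccos c ^ 2) * angleDivSin c

theorem _root_.LocallyLipschitzOn.comp_of_forall_mem {X Y Z : Type*} [PseudoEMetricSpace X]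
    [PseudoEMetricSpace Y] [PseudoEMetricSpace Z] {f : Y → Z} {s : Set Y} {k : X → Y}
    (hf : LocallyLipschitzOn s f) (hk : LocallyLipschitz k) (h : ∀ x, k x ∈ s) :
    LocallyLipschitz fun x => f (k x) := by
  intro x
  obtain ⟨K, t, ht, hK⟩ := hf (h x)
  obtain ⟨K', t', ht', hK'⟩ := hk x
  have hkx : Filter.Tendsto k (𝓝 x) (𝓝[s] (k x)) :=
    tendsto_nhdsWithin_iff.2 ⟨hk.continuous.continuousAt, Filter.Eventually.of_forall h⟩
  exact ⟨K * K', t' ∩ k ⁻¹' t, Filter.inter_mem ht' (hkx ht),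
    hK.comp (hK'.mono inter_subset_left) fun y hy => hy.2⟩

theorem _root_.LocallyLipschitz.smul_of_real {X E : Type*} [PseudoEMetricSpace X]
    [NormedAddCommGroup E]
    [NormedSpace ℝ E] {f : X → ℝ} {k : X → E} (hf : LocallyLipschitz f)
    (hk : LocallyLipschitz k) : LocallyLipschitz fun x => f x • k x := by
  have h : LocallyLipschitz fun p : ℝ × E => p.1 • p.2 :=
    (contDiff_fst.smul contDiff_snd : ContDiff ℝ 1 _).locallyLipschitz
  exact h.comp (hf.prodMk hk)

theorem LipschitzOnWith.locallyLipschitzOn' {X Y : Type*} [PseudoEMetricSpace X]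
    [PseudoEMetricSpace Y] {f : X → Y} {s : Set X} {K : ℝ≥0} (hf : LipschitzOnWith K f s) :
    LocallyLipschitzOn s f := fun _ _ => ⟨K, s, self_mem_nhdsWithin, hf⟩

/-- The force factor with its argument clamped to `[c₀, 1]` is locally Lipschitz. -/
theorem locallyLipschitz_forceFactor_clamp {g : ℝ → ℝ}
    (hg : LocallyLipschitzOn (Ici 0) (derivWithin g (Ici 0))) {c₀ : ℝ} (h0 : -1 < c₀)
    (h1 : c₀ ≤ 1) : LocallyLipschitz fun c => forceFactor g (max c₀ (min c 1)) := by
  have hcl : LocallyLipschitz fun c : ℝ => max c₀ (min c 1) :=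
    (LocallyLipschitz.id.min_const 1).const_max c₀
  have hmem : ∀ c : ℝ, max c₀ (min c 1) ∈ Icc c₀ 1 := fun c =>
    ⟨le_max_left _ _, max_le h1 (min_le_right _ _)⟩
  obtain ⟨L₁, hL₁⟩ := exists_lipschitzOnWith_arccos_sq h0
  obtain ⟨L₂, hL₂⟩ := exists_lipschitzOnWith_angleDivSin h0
  have ha := (LipschitzOnWith.locallyLipschitzOn' hL₁).comp_of_forall_mem hcl hmem
  have hb := (LipschitzOnWith.locallyLipschitzOn' hL₂).comp_of_forall_mem hcl hmem
  exact (hg.comp_of_forall_mem ha fun c => mem_Ici.2 (sq_nonneg _)).smul_of_real hb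

theorem eq_zero_of_metric_self_eq_zero {V : Mat3} (h : metric V V = 0) : V = 0 := by
  rw [metric, ← Matrix.conjTranspose_eq_transpose_of_trivial] at h
  exact Matrix.trace_conjTranspose_mul_self_eq_zero_iff.1 (by linarith)

theorem metric_sub_left (V V' W : Mat3) : metric (V - V') W = metric V W - metric V' W := by
  simp only [metric, Matrix.transpose_sub, Matrix.sub_mul, Matrix.trace_sub]
  ring

/-- Tested along geodesics, the difference of two gradients is orthogonal to every unit tangent
vector, in particular to its own normalization. This identifies the vector chosen by `gradient`. -/
theorem IsGradientAt.unique {f : SO3 → ℝ} {R : SO3} {V V' : Mat3} (h : IsGradientAt f R V)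
    (h' : IsGradientAt f R V') : V = V' := by
  obtain ⟨⟨B, hB, rfl⟩, hd⟩ := h
  obtain ⟨⟨B', hB', rfl⟩, hd'⟩ := h'
  have hD : (B - B')ᵀ = -(B - B') := by rw [Matrix.transpose_sub, hB, hB']; abel
  have key : ∀ A : Mat3, Aᵀ = -A → metric A A = 1 → metric (B - B') A = 0 := by
    intro A hA hA1
    have hg := hasDerivAt_geodesic R hA hA1 0
    have h0 := geodesic_zero R hA hA1
    rw [h0] at hg
    have e := (hd _ _ h0 hg).unique (hd' _ _ h0 hg)
    rw [metric_mul_left, metric_mul_left] at e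
    rw [metric_sub_left, e, sub_self]
  rw [← sub_eq_zero, ← mul_sub]
  suffices hz : metric (B - B') (B - B') = 0 by
    rw [eq_zero_of_metric_self_eq_zero hz, mul_zero]
  by_contra hne
  have hpos : 0 < metric (B - B') (B - B') := (metric_self_nonneg _).lt_of_ne' hne
  have hs := Real.sqrt_pos.2 hpos
  have h1 := key ((√(metric (B - B') (B - B')))⁻¹ • (B - B'))
    (by rw [Matrix.transpose_smul, hD, smul_neg])
    (by
      rw [metric_smul_smul, ← mul_inv, Real.mul_self_sqrt hpos.le]
      exact inv_mul_cancel₀ hne)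
  have h2 := metric_smul_smul 1 (√(metric (B - B') (B - B')))⁻¹ (B - B') (B - B')
  rw [one_smul, h1, one_mul] at h2
  exact hne ((mul_eq_zero.1 h2.symm).resolve_left (inv_pos.2 hs).ne')

theorem IsGradientAt.gradient_eq {f : SO3 → ℝ} {R : SO3} {V : Mat3} (h : IsGradientAt f R V) :
    gradient f R = V := by
  have hex : ∃ V, IsGradientAt f R V := ⟨V, h⟩
  rw [gradient, dif_pos hex]
  exact hex.choose_spec.unique h

/-- The direction of the force that `Q` exerts at `X`; on `SO(3)` it equals `Q - X Qᵀ X`. -/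
def forceDir (X Q : Mat3) : Mat3 := X * (Xᵀ * Q - Qᵀ * X)

theorem trace_transpose_mul_skew (M : Mat3) {A : Mat3} (hA : Aᵀ = -A) :
    (Mᵀ * A).trace = -(M * A).trace := by
  rw [← Matrix.trace_transpose, Matrix.transpose_mul, Matrix.transpose_transpose, hA,
    Matrix.neg_mul, Matrix.trace_neg, Matrix.trace_mul_comm]

theorem isGradientAt_potential {K : SO3 → SO3 → ℝ} {g : ℝ → ℝ}
    (hg : DifferentiableOn ℝ g (Ici 0))
    (hK : ∀ R Q : SO3, K R Q = g (riemannianDist R Q ^ 2)) {R Q : SO3}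
    (hc : -1 < cosAngle R Q) :
    IsGradientAt (fun P => K P Q) R (-forceFactor g (cosAngle R Q) • forceDir R Q) := by
  refine ⟨⟨-forceFactor g (cosAngle R Q) • ((R : Mat3)ᵀ * Q - (Q : Mat3)ᵀ * R), ?_, ?_⟩, ?_⟩
  · rw [Matrix.transpose_smul, Matrix.transpose_sub, Matrix.transpose_mul, Matrix.transpose_mul,
      Matrix.transpose_transpose, Matrix.transpose_transpose, ← smul_neg, neg_sub]
  · rw [forceDir, mul_smul_comm]
  intro γ W h0 hγ
  obtain ⟨A, hA, rfl⟩ := exists_skew_of_hasDerivAt hγ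
  rw [h0]
  have hcos : HasDerivAt (fun s => cosAngle (Q : Mat3) (γ s))
      (((Q : Mat3)ᵀ * ((R : Mat3) * A)).trace / 2) 0 := by
    have := hasDerivWithinAt_univ.1
      (hasDerivWithinAt_cosAngle (s := univ) (Q : Mat3) hγ.hasDerivWithinAt)
    rwa [h0] at this
  have e0 : cosAngle (Q : Mat3) (γ 0) = cosAngle R Q := by rw [h0, cosAngle_comm]
  have hφ : HasDerivWithinAt (fun c => Real.arccos c ^ 2) (-2 * angleDivSin (cosAngle R Q)) (Iic 1)
      (cosAngle (Q : Mat3) (γ 0)) := by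
    rw [e0]; exact hasDerivWithinAt_arccos_sq hc (cosAngle_le_one R Q)
  -- One-sided chain rules suffice even at R = Q: the cosine never exceeds 1 and the squared angle
  -- is never negative, so each inner map stays where the outer one is differentiable.
  have h1 := HasDerivWithinAt.comp (h₂ := fun c => Real.arccos c ^ 2) (s := univ) 0 hφ
    hcos.hasDerivWithinAt (fun s _ => cosAngle_le_one Q (γ s))
  have hg' : HasDerivWithinAt g (derivWithin g (Ici 0) (Real.arccos (cosAngle R Q) ^ 2)) (Ici 0)
      (Real.arccos (cosAngle (Q : Mat3) (γ 0)) ^ 2) := by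
    rw [e0]; exact (hg _ (mem_Ici.2 (sq_nonneg _))).hasDerivWithinAt
  have h2 := HasDerivWithinAt.comp (h₂ := g)
    (h := fun s => Real.arccos (cosAngle (Q : Mat3) (γ s)) ^ 2) 0 hg' h1
    (fun s _ => mem_Ici.2 (sq_nonneg _))
  have hev : (fun s => K (γ s) Q) =ᶠ[𝓝 0]
      fun s => g (Real.arccos (cosAngle (Q : Mat3) (γ s)) ^ 2) := by
    have : ∀ᶠ s in 𝓝 (0 : ℝ), -1 < cosAngle (Q : Mat3) (γ s) :=
      hcos.continuousAt.eventually (Ioi_mem_nhds (show -1 < cosAngle (Q : Mat3) (γ 0) by rwa [e0]))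
    filter_upwards [this] with s hs
    rw [cosAngle_comm] at hs
    rw [hK, riemannianDist_eq_arccos hs, cosAngle_comm]
  refine ((hasDerivWithinAt_univ.1 h2).congr_of_eventuallyEq hev).congr_deriv ?_
  have hm := metric_smul_smul (-forceFactor g (cosAngle R Q)) 1 (forceDir R Q) ((R : Mat3) * A)
  rw [one_smul] at hm
  have ht := trace_transpose_mul_skew ((Q : Mat3)ᵀ * R) hA
  have hm2 : metric (forceDir R Q) ((R : Mat3) * A)
      = ((Q : Mat3)ᵀ * ((R : Mat3) * A)).trace := by
    rw [forceDir, metric_mul_left, metric, Matrix.transpose_sub, Matrix.sub_mul, Matrix.trace_sub,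
      ht, Matrix.transpose_mul, Matrix.transpose_transpose, ← mul_assoc]
    ring
  rw [hm, hm2, forceFactor]
  ring

/-- The force exerted by `Q` at `X`, extended to all matrices, with the cosine of the angle
clamped to `[c₀, 1]`. -/
noncomputable def force (g : ℝ → ℝ) (c₀ : ℝ) (X Q : Mat3) : Mat3 :=
  forceFactor g (max c₀ (min (cosAngle X Q) 1)) • forceDir X Q

theorem contDiff_mat_iff {E : Type*} [NormedAddCommGroup E] [NormedSpace ℝ E] {f : E → Mat3}
    {n : WithTop ℕ∞} : ContDiff ℝ n f ↔ ∀ i j, ContDiff ℝ n fun x => f x i j := by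
  have h : ContDiff ℝ n f ↔ ∀ i, ContDiff ℝ n fun x => f x i :=
    contDiff_pi (F' := fun _ : Fin 3 => Fin 3 → ℝ) (Φ := f)
  exact h.trans <| forall_congr' fun i => contDiff_pi

theorem contDiff_fst_apply (i j : Fin 3) :
    ContDiff ℝ 1 fun p : Mat3 × Mat3 => p.1 i j :=
  contDiff_mat_iff.1 contDiff_fst i j

theorem contDiff_snd_apply (i j : Fin 3) :
    ContDiff ℝ 1 fun p : Mat3 × Mat3 => p.2 i j :=
  contDiff_mat_iff.1 contDiff_snd i j

theorem contDiff_forceDir : ContDiff ℝ 1 fun p : Mat3 × Mat3 => forceDir p.1 p.2 := by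
  have h1 := contDiff_fst_apply
  have h2 := contDiff_snd_apply
  refine contDiff_mat_iff.2 fun i j => ?_
  simp only [forceDir, Matrix.mul_apply, Matrix.sub_apply, Matrix.transpose_apply]
  fun_prop (disch := simp [h1, h2])

theorem contDiff_cosAngle : ContDiff ℝ 1 fun p : Mat3 × Mat3 => cosAngle p.1 p.2 := by
  have h1 := contDiff_fst_apply
  have h2 := contDiff_snd_apply
  simp only [cosAngle, Matrix.mul_apply, Matrix.trace, Matrix.diag, Matrix.transpose_apply]
  fun_prop (disch := simp [h1, h2])

theorem locallyLipschitz_force {g : ℝ → ℝ}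
    (hg : LocallyLipschitzOn (Ici 0) (derivWithin g (Ici 0))) {c₀ : ℝ} (h0 : -1 < c₀)
    (h1 : c₀ ≤ 1) : LocallyLipschitz fun p : Mat3 × Mat3 => force g c₀ p.1 p.2 :=
  ((locallyLipschitz_forceFactor_clamp hg h0 h1).comp
    contDiff_cosAngle.locallyLipschitz).smul_of_real contDiff_forceDir.locallyLipschitz

theorem gradient_potential_eq {K : SO3 → SO3 → ℝ} {g : ℝ → ℝ}
    (hg : DifferentiableOn ℝ g (Ici 0))
    (hK : ∀ R Q : SO3, K R Q = g (riemannianDist R Q ^ 2)) {c₀ : ℝ} (h0 : -1 < c₀) {R Q : SO3}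
    (hc : c₀ ≤ cosAngle R Q) : gradient (fun P => K P Q) R = -force g c₀ R Q := by
  rw [(isGradientAt_potential hg hK (h0.trans_le hc)).gradient_eq, force,
    min_eq_left (cosAngle_le_one R Q), max_eq_right hc, neg_smul]

/-- The force is tangent to the orthogonal group. -/
theorem force_mul_transpose_add (g : ℝ → ℝ) (c₀ : ℝ) (X Q : Mat3) :
    force g c₀ X Q * Xᵀ + X * (force g c₀ X Q)ᵀ = 0 := by
  simp only [force, forceDir, Matrix.transpose_smul, smul_mul_assoc, mul_smul_comm,
    Matrix.transpose_mul, Matrix.transpose_sub, Matrix.transpose_transpose]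
  rw [← smul_add]
  convert smul_zero _ using 2
  noncomm_ring

/-! ### The mean-field ODE: existence and a contraction principle. -/

section MeanField

variable {S E : Type*} [TopologicalSpace S] [CompactSpace S] [T2Space S] [SecondCountableTopology S]
  [MeasurableSpace S] [BorelSpace S] [NormedAddCommGroup E] [NormedSpace ℝ E]

/-- The mean-field vector field on `C(S, E)` of an interaction `w`. -/
noncomputable def meanField {w : E → E → E} (hw : Continuous fun p : E × E => w p.1 p.2)
    (ν : Measure S) [IsFiniteMeasure ν] (Φ : C(S, E)) : C(S, E) where
  toFun x := ∫ y, w (Φ x) (Φ y) ∂ν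
  continuous_toFun := by
    have h : Continuous (Function.uncurry fun x y => w (Φ x) (Φ y)) := by
      have : Continuous fun q : S × S => (Φ q.1, Φ q.2) := by fun_prop
      exact hw.comp this
    simpa using continuous_parametric_integral_of_continuous (μ := ν) h isCompact_univ

/-- Picard–Lindelöf in C(S, E). Maps within 1 of Φ₀ take values in a fixed compact ball, where w is
bounded and Lipschitz; integrating against a probability measure preserves both constants. -/
theorem exists_meanField_solution [ProperSpace E] {w : E → E → E}
    (hw : LocallyLipschitz fun p : E × E => w p.1 p.2)
    (ν : Measure S) [IsProbabilityMeasure ν] (Φ₀ : C(S, E)) :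
    ∃ τ : ℝ, 0 < τ ∧ ∃ α : ℝ → C(S, E), α 0 = Φ₀ ∧
      ∀ t ∈ Icc (-τ) τ, HasDerivWithinAt α (meanField hw.continuous ν (α t)) (Icc (-τ) τ) t := by
  set B : Set (E × E) := Metric.closedBall 0 (‖Φ₀‖ + 1) with hB
  have hBc : IsCompact B := isCompact_closedBall _ _
  obtain ⟨L, hL⟩ := LocallyLipschitzOn.exists_lipschitzOnWith_of_compact hBc
    (hw.locallyLipschitzOn (s := B))
  obtain ⟨C, hC⟩ := hBc.exists_bound_of_continuousOn hw.continuous.continuousOn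
  have hmem : ∀ Φ ∈ Metric.closedBall Φ₀ 1, ∀ x y : S, (Φ x, Φ y) ∈ B := by
    intro Φ hΦ x y
    have h1 : ‖Φ‖ ≤ ‖Φ₀‖ + 1 := by
      have h2 : ‖Φ - Φ₀‖ ≤ 1 := mem_closedBall_iff_norm.1 hΦ
      linarith [norm_sub_norm_le Φ Φ₀]
    rw [hB, mem_closedBall_zero_iff, Prod.norm_def]
    exact max_le ((Φ.norm_coe_le_norm x).trans h1) ((Φ.norm_coe_le_norm y).trans h1)
  have hC0 : 0 ≤ C := by
    refine (norm_nonneg _).trans (hC 0 ?_)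
    simp only [hB, Metric.mem_closedBall, dist_self]
    positivity
  have hint : ∀ (Φ : C(S, E)) (x : S), Integrable (fun y => w (Φ x) (Φ y)) ν := by
    intro Φ x
    have : Continuous fun y => w (Φ x) (Φ y) :=
      hw.continuous.comp (continuous_const.prodMk Φ.continuous)
    exact this.integrable_of_hasCompactSupport (HasCompactSupport.of_compactSpace _)
  -- At speed at most C, the curve moves by at most Cτ ≤ 1 and stays in the unit ball about Φ₀.
  set τ : ℝ := (C + 1)⁻¹ with hτ
  have hτ0 : 0 < τ := by positivity
  have hP : IsPicardLindelof (fun _ => meanField hw.continuous ν) (tmin := -τ) (tmax := τ)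
      ⟨0, by simp [hτ0.le]⟩ Φ₀ 1 0 C.toNNReal L := by
    refine IsPicardLindelof.of_time_independent ?_ ?_ ?_
    · intro Φ hΦ
      rw [Real.coe_toNNReal _ hC0, ContinuousMap.norm_le _ hC0]
      intro x
      refine (norm_integral_le_of_norm_le_const (C := C)
        (Filter.Eventually.of_forall fun y => hC _ (hmem Φ hΦ x y))).trans ?_
      simp
    · refine LipschitzOnWith.of_dist_le_mul fun Φ hΦ Ψ hΨ => ?_
      rw [ContinuousMap.dist_le (by positivity)]
      intro x
      change dist (∫ y, w (Φ x) (Φ y) ∂ν) (∫ y, w (Ψ x) (Ψ y) ∂ν) ≤ _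
      rw [dist_eq_norm, ← integral_sub (hint Φ x) (hint Ψ x)]
      refine (norm_integral_le_of_norm_le_const (C := L * dist Φ Ψ)
        (Filter.Eventually.of_forall fun y => ?_)).trans ?_
      · rw [← dist_eq_norm]
        refine (hL.dist_le_mul _ (hmem Φ hΦ x y) _ (hmem Ψ hΨ x y)).trans ?_
        rw [Prod.dist_eq]
        gcongr
        exact max_le (ContinuousMap.dist_apply_le_dist x) (ContinuousMap.dist_apply_le_dist y)
      · simp
    · rw [Real.coe_toNNReal _ hC0]
      simp only [sub_zero, zero_sub, neg_neg, max_self, NNReal.coe_one, NNReal.coe_zero]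
      rw [hτ, ← div_eq_mul_inv, div_le_one (by positivity)]
      linarith
  obtain ⟨α, h0, hα⟩ := hP.exists_eq_forall_mem_Icc_hasDerivWithinAt₀
  exact ⟨τ, hτ0, α, h0, hα⟩

/-- A substitute for Grönwall, uniform in i: by the mean value inequality every common bound D
improves to LTD ≤ D/2, so iteration from B gives 0. The derivative of one f i may depend on all the
others, as mean-field coupling requires. -/
theorem eq_zero_of_norm_deriv_le_of_norm_le {ι : Type*} {f f' : ι → ℝ → E} {T L B : ℝ}
    (hLT : L * T ≤ 1 / 2)
    (h0 : ∀ i, f i 0 = 0)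
    (hf : ∀ i, ∀ t ∈ Ico 0 T, HasDerivWithinAt (f i) (f' i t) (Ico 0 T) t)
    (hB : ∀ i, ∀ t ∈ Ico 0 T, ‖f i t‖ ≤ B)
    (hf' : ∀ D, (∀ i, ∀ t ∈ Ico 0 T, ‖f i t‖ ≤ D) → ∀ i, ∀ t ∈ Ico 0 T, ‖f' i t‖ ≤ L * D) :
    ∀ i, ∀ t ∈ Ico 0 T, f i t = 0 := by
  have key : ∀ n : ℕ, ∀ i, ∀ t ∈ Ico 0 T, ‖f i t‖ ≤ |B| * (1 / 2) ^ n := by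
    intro n
    induction n with
    | zero => intro i t ht; simpa using (hB i t ht).trans (le_abs_self B)
    | succ n ih =>
      intro i t ht
      have h1 := (convex_Ico 0 T).norm_image_sub_le_of_norm_hasDerivWithin_le (hf i)
        (hf' _ ih i) (left_mem_Ico.2 (ht.1.trans_lt ht.2)) ht
      rw [h0, sub_zero, sub_zero, Real.norm_of_nonneg ht.1] at h1
      have hLD : 0 ≤ L * (|B| * (1 / 2) ^ n) := (norm_nonneg _).trans (hf' _ ih i t ht)
      calc ‖f i t‖ ≤ L * (|B| * (1 / 2) ^ n) * t := h1
        _ ≤ L * (|B| * (1 / 2) ^ n) * T := by gcongr; exact ht.2.le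
        _ = (L * T) * (|B| * (1 / 2) ^ n) := by ring
        _ ≤ 1 / 2 * (|B| * (1 / 2) ^ n) := by gcongr
        _ = |B| * (1 / 2) ^ (n + 1) := by ring
  intro i t ht
  have hlim : Filter.Tendsto (fun n : ℕ => |B| * (1 / 2 : ℝ) ^ n) Filter.atTop (𝓝 0) := by
    simpa using (tendsto_pow_atTop_nhds_zero_of_lt_one (r := (1 / 2 : ℝ)) (by norm_num)
      (by norm_num)).const_mul |B|
  exact norm_le_zero_iff.1 (ge_of_tendsto' hlim fun n => key n i t ht)

end MeanField

theorem exists_bounds_of_locallyLipschitz {E : Type*} [NormedAddCommGroup E] [ProperSpace E]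
    {w : E → E → E} (hw : LocallyLipschitz fun p : E × E => w p.1 p.2) (b : ℝ) :
    ∃ L C : ℝ, 0 ≤ L ∧
      (∀ X Y X' Y' : E, ‖X‖ ≤ b → ‖Y‖ ≤ b → ‖X'‖ ≤ b → ‖Y'‖ ≤ b →
        ‖w X Y - w X' Y'‖ ≤ L * max ‖X - X'‖ ‖Y - Y'‖) ∧
      ∀ X Y : E, ‖X‖ ≤ b → ‖Y‖ ≤ b → ‖w X Y‖ ≤ C := by
  have hBc : IsCompact (Metric.closedBall (0 : E × E) b) := isCompact_closedBall _ _
  obtain ⟨L, hL⟩ := LocallyLipschitzOn.exists_lipschitzOnWith_of_compact hBc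
    (hw.locallyLipschitzOn (s := Metric.closedBall 0 b))
  obtain ⟨C, hC⟩ := hBc.exists_bound_of_continuousOn hw.continuous.continuousOn
  have hmem : ∀ X Y : E, ‖X‖ ≤ b → ‖Y‖ ≤ b → (X, Y) ∈ Metric.closedBall (0 : E × E) b := by
    intro X Y hX hY
    rw [mem_closedBall_zero_iff, Prod.norm_def]
    exact max_le hX hY
  refine ⟨L, C, L.2, fun X Y X' Y' hX hY hX' hY' => ?_, fun X Y hX hY => hC _ (hmem X Y hX hY)⟩
  have h := hL.dist_le_mul _ (hmem X Y hX hY) _ (hmem X' Y' hX' hY')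
  rwa [Prod.dist_eq, dist_eq_norm, dist_eq_norm, dist_eq_norm] at h

theorem norm_SO3_le_one (R : SO3) : ‖(R : Mat3)‖ ≤ 1 :=
  entrywise_sup_norm_bound_of_unitary (Matrix.mem_specialOrthogonalGroup_iff.1 R.2).1

theorem continuous_coe_SO3 : Continuous fun R : SO3 => (R : Mat3) := continuous_subtype_val

instance instProperSpaceMat3 : ProperSpace Mat3 := FiniteDimensional.proper_real Mat3

instance instSecondCountableTopologyMat3 : SecondCountableTopology Mat3 :=
  inferInstanceAs (SecondCountableTopology (Fin 3 → Fin 3 → ℝ))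

/-- The symmetric part of `V Xᵀ`, as a continuous linear map of `V`. -/
noncomputable def orthDefect (X : Mat3) : Mat3 →L[ℝ] Mat3 :=
  LinearMap.toContinuousLinearMap
    { toFun := fun V => V * Xᵀ + X * Vᵀ
      map_add' := fun V W => by
        rw [Matrix.transpose_add, add_mul, mul_add]; abel
      map_smul' := fun a V => by
        rw [Matrix.transpose_smul, smul_mul_assoc, mul_smul_comm, ← smul_add]; rfl }

theorem orthDefect_apply (X V : Mat3) : orthDefect X V = V * Xᵀ + X * Vᵀ := rfl

theorem integral_mat_apply {Ω : Type*} [MeasurableSpace Ω] {μ : Measure Ω} {f : Ω → Mat3}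
    (hf : Integrable f μ) (i j : Fin 3) : (∫ ω, f ω ∂μ) i j = ∫ ω, f ω i j ∂μ :=
  (ContinuousLinearMap.integral_comp_comm
    (LinearMap.toContinuousLinearMap (Matrix.entryLinearMap ℝ ℝ i j) : Mat3 →L[ℝ] ℝ) hf).symm

theorem _root_.LocallyLipschitz.continuous_force {g : ℝ → ℝ} {c₀ : ℝ}
    (hw : LocallyLipschitz fun p : Mat3 × Mat3 => force g c₀ p.1 p.2) {X : Type*}
    [TopologicalSpace X] {f h : X → Mat3} (hf : Continuous f) (hh : Continuous h) :
    Continuous fun x => force g c₀ (f x) (h x) :=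
  Continuous.comp (g := fun p : Mat3 × Mat3 => force g c₀ p.1 p.2) (f := fun x => (f x, h x))
    hw.continuous (hf.prodMk hh)

/-! ### The flow stays in the geodesic disk. -/

section Flow

variable {S : Type*} [TopologicalSpace S] [CompactSpace S] [T2Space S] [SecondCountableTopology S]
  [MeasurableSpace S] [BorelSpace S]

/-- Short-time existence of the mean-field flow in a geodesic disk. -/
theorem exists_flow {g : ℝ → ℝ} {c₀ r : ℝ}
    (hw : LocallyLipschitz fun p : Mat3 × Mat3 => force g c₀ p.1 p.2)
    (hr0 : 0 < r) (hr : r ≤ Real.pi) (ν : Measure S) [IsProbabilityMeasure ν]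
    (j : C(S, geodesicDisk r)) :
    ∃ τ : ℝ, 0 < τ ∧ ∃ P : S → ℝ → geodesicDisk r, (∀ x, P x 0 = j x) ∧
      (∀ t, Continuous fun x => P x t) ∧
      ∀ x, ∀ t ∈ Ico 0 τ, HasDerivWithinAt (fun s => ((P x s : SO3) : Mat3))
        (∫ y, force g c₀ (P x t : SO3) (P y t : SO3) ∂ν) (Ico 0 τ) t := by
  set Φ₀ : C(S, Mat3) := ⟨fun x => ((j x : SO3) : Mat3),
    continuous_coe_SO3.comp (continuous_subtype_val.comp j.continuous)⟩ with hΦ₀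
  obtain ⟨τ₀, hτ₀, α, hα0, hα⟩ := exists_meanField_solution (w := force g c₀) hw ν Φ₀
  have hO : IsOpen {X : Mat3 | Real.cos r < cosAngle (1 : Mat3) X} := by
    have : Continuous fun X : Mat3 => cosAngle (1 : Mat3) X := by
      unfold cosAngle; fun_prop
    exact isOpen_lt continuous_const this
  -- Compactness of S makes the disk condition open for uniform convergence, so it persists for a
  -- short time common to all x.
  have hOS : IsOpen {Φ : C(S, Mat3) | MapsTo Φ univ {X | Real.cos r < cosAngle (1 : Mat3) X}} :=
    ContinuousMap.isOpen_setOfPred_mapsTo isCompact_univ hO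
  have h0mem : (0 : ℝ) ∈ Icc (-τ₀) τ₀ := ⟨by linarith, hτ₀.le⟩
  have hcont : ContinuousAt α 0 :=
    (hα 0 h0mem).continuousWithinAt.continuousAt (Icc_mem_nhds (by linarith) hτ₀)
  have hev : ∀ᶠ t in 𝓝 (0 : ℝ), MapsTo (α t) univ {X | Real.cos r < cosAngle (1 : Mat3) X} := by
    refine hcont.eventually (hOS.mem_nhds ?_)
    intro x _
    rw [hα0]
    exact (mem_geodesicDisk_iff hr0 hr _).1 (j x).2
  obtain ⟨τ₁, hτ₁, hball⟩ := Metric.eventually_nhds_iff.1 hev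
  set τ := min τ₀ τ₁ with hτ
  have hsub : Ico 0 τ ⊆ Icc (-τ₀) τ₀ := fun t ht =>
    ⟨by linarith [ht.1], (ht.2.trans_le (min_le_left _ _)).le⟩
  have hdisk : ∀ t ∈ Ico 0 τ, ∀ x, Real.cos r < cosAngle (1 : Mat3) (α t x) := fun t ht x =>
    hball (by rw [Real.dist_0_eq_abs, abs_of_nonneg ht.1]; exact ht.2.trans_le (min_le_right _ _))
      (mem_univ x)
  have hder : ∀ x, ∀ t ∈ Ico 0 τ, HasDerivWithinAt (fun s => α s x)
      (∫ y, force g c₀ (α t x) (α t y) ∂ν) (Ico 0 τ) t := fun x t ht => by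
    have h := ((ContinuousMap.evalCLM ℝ x).hasFDerivAt (x := α t)).comp_hasDerivWithinAt t
      ((hα t (hsub ht)).mono hsub)
    exact h
  have hint : ∀ t x, Integrable (fun y => force g c₀ (α t x) (α t y)) ν := fun t x =>
    (hw.continuous_force continuous_const (α t).continuous).integrable_of_hasCompactSupport
      (HasCompactSupport.of_compactSpace _)
  have hzero : (0 : ℝ) ∈ Ico 0 τ := ⟨le_rfl, lt_min hτ₀ hτ₁⟩
  have horth : ∀ x, ∀ t ∈ Ico 0 τ, α t x * (α t x)ᵀ = 1 := by
    intro x t ht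
    -- The tangency identity of the force holds at every matrix, so XXᵀ is constant without knowing
    -- beforehand that X is orthogonal.
    have hd : ∀ t ∈ Ico 0 τ, HasDerivWithinAt (fun s => α s x * (α s x)ᵀ) 0 (Ico 0 τ) t := by
      intro t ht
      have h1 := hasDerivWithinAt_mat_mul (hder x t ht)
        (hasDerivWithinAt_mat_transpose (hder x t ht))
      have h2 := (orthDefect (α t x)).integral_comp_comm (hint t x)
      simp only [orthDefect_apply, force_mul_transpose_add, integral_zero] at h2
      rwa [← h2] at h1
    have h1 := (convex_Ico 0 τ).norm_image_sub_le_of_norm_hasDerivWithin_le (C := 0) hd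
      (fun _ _ => by simp) hzero ht
    rw [zero_mul] at h1
    have h2 := sub_eq_zero.1 (norm_le_zero_iff.1 h1)
    rw [h2, hα0]
    exact (j x : SO3).mul_transpose_self
  have hdet : ∀ x, ∀ t ∈ Ico 0 τ, (α t x).det = 1 := by
    intro x t ht
    have hsq : ∀ s ∈ Ico 0 τ, (α s x).det * (α s x).det = 1 := by
      intro s hs
      have := congrArg Matrix.det (horth x s hs)
      rwa [Matrix.det_mul, Matrix.det_transpose, Matrix.det_one] at this
    rcases mul_self_eq_one_iff.1 (hsq t ht) with h | h
    · exact h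
    exfalso
    -- A determinant going continuously from 1 to −1 would vanish, although its square is always 1.
    have hIs : Icc 0 t ⊆ Ico 0 τ := fun s hs => ⟨hs.1, hs.2.trans_lt ht.2⟩
    have hdc : Continuous fun X : Mat3 => X.det := by fun_prop
    have hc : ContinuousOn (fun s => (α s x).det) (Icc 0 t) := hdc.comp_continuousOn
      fun s hs => ((hder x s (hIs hs)).continuousWithinAt).mono hIs
    have hd0 : (α 0 x).det = 1 := by rw [hα0]; exact (j x : SO3).det_eq_one
    obtain ⟨s, hs, hs0⟩ := intermediate_value_Icc' ht.1 hc
      (show (0 : ℝ) ∈ Icc (α t x).det (α 0 x).det by rw [h, hd0]; norm_num)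
    have := hsq s (hIs hs)
    simp only at hs0
    rw [hs0] at this
    norm_num at this
  -- The value `j x` outside [0, τ) is a default that keeps x ↦ P x t continuous for every t.
  refine ⟨τ, hzero.2, fun x t => if ht : t ∈ Ico 0 τ then
    ⟨⟨α t x, mem_SO3_of (horth x t ht) (hdet x t ht)⟩,
      (mem_geodesicDisk_iff hr0 hr _).2 (hdisk t ht x)⟩ else j x, ?_, ?_, ?_⟩
  · intro x
    simp only [dif_pos hzero]
    apply Subtype.ext
    apply Subtype.ext
    change α 0 x = _
    rw [hα0]
    rfl
  · intro t
    by_cases ht : t ∈ Ico 0 τ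
    · simp only [dif_pos ht]
      exact ((α t).continuous.subtype_mk _).subtype_mk _
    · simp only [dif_neg ht]
      exact j.continuous
  · intro x t ht
    simp only [dif_pos ht]
    refine (hder x t ht).congr (fun s hs => ?_) ?_
    · simp only [dif_pos hs]
    · simp only [dif_pos ht]

end Flow

/-! ### Velocity as an integral of the force, and comparison of flows. -/

theorem integrable_force {Ω : Type*} [MeasurableSpace Ω] {μ : Measure Ω} [IsFiniteMeasure μ]
    {g : ℝ → ℝ} {c₀ : ℝ} (hw : LocallyLipschitz fun p : Mat3 × Mat3 => force g c₀ p.1 p.2)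
    (R : SO3) {h : Ω → SO3} (hh : AEMeasurable h μ) :
    Integrable (fun ω => force g c₀ R (h ω)) μ := by
  obtain ⟨L, C, -, -, hC⟩ := exists_bounds_of_locallyLipschitz (w := force g c₀) hw 1
  have hcont : Continuous fun Q : SO3 => force g c₀ R Q :=
    hw.continuous_force continuous_const continuous_coe_SO3
  exact Integrable.of_bound (hcont.comp_aestronglyMeasurable hh.aestronglyMeasurable) C
    (Filter.Eventually.of_forall fun ω => hC R (h ω) (norm_SO3_le_one _) (norm_SO3_le_one _))

theorem velocity_eq {K : SO3 → SO3 → ℝ} {g : ℝ → ℝ} (hg : DifferentiableOn ℝ g (Ici 0))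
    (hK : ∀ R Q : SO3, K R Q = g (riemannianDist R Q ^ 2)) {c₀ : ℝ} (h0 : -1 < c₀)
    (hw : LocallyLipschitz fun p : Mat3 × Mat3 => force g c₀ p.1 p.2) {U : Set SO3}
    (hU : ∀ R ∈ U, ∀ Q ∈ U, c₀ ≤ cosAngle R Q) (ρ : ℝ → ProbabilityMeasure U) (R : U) (t : ℝ) :
    velocity K ρ R t = ∫ Q : U, force g c₀ (R : SO3) (Q : SO3) ∂(ρ t : Measure U) := by
  ext i j
  rw [integral_mat_apply (integrable_force hw R measurable_subtype_coe.aemeasurable)]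
  simp only [velocity, Matrix.of_apply, ← integral_neg]
  refine integral_congr_ae (Filter.Eventually.of_forall fun Q => ?_)
  simp only [gradient_potential_eq hg hK h0 (hU R R.2 Q Q.2), Matrix.neg_apply, neg_neg]

theorem norm_integral_sub_integral_le {Ω E : Type*} [MeasurableSpace Ω] {μ : Measure Ω}
    [IsProbabilityMeasure μ] [NormedAddCommGroup E] [NormedSpace ℝ E] {F G : Ω → E}
    (hF : Integrable F μ) (hG : Integrable G μ) {D : ℝ} (h : ∀ᵐ ω ∂μ, ‖F ω - G ω‖ ≤ D) :
    ‖∫ ω, F ω ∂μ - ∫ ω, G ω ∂μ‖ ≤ D := by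
  rw [← integral_sub hF hG]
  simpa using norm_integral_le_of_norm_le_const h

theorem IsFlowMap.eq_of_norm_sub_le {U : Set SO3} {X Y : U → ℝ → Mat3} {S : Set U} {T L : ℝ}
    {Φ Ψ : U → ℝ → U} (hΦ : IsFlowMap X S T Φ) (hΨ : IsFlowMap Y S T Ψ) (hLT : L * T ≤ 1 / 2)
    (h : ∀ D : ℝ, (∀ R ∈ S, ∀ t ∈ Ico 0 T, ‖((Φ R t : SO3) : Mat3) - (Ψ R t : SO3)‖ ≤ D) →
      ∀ R ∈ S, ∀ t ∈ Ico 0 T, ‖X (Φ R t) t - Y (Ψ R t) t‖ ≤ L * D) :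
    ∀ R ∈ S, ∀ t ∈ Ico 0 T, Φ R t = Ψ R t := by
  -- The a priori bound 2 comes from the entries of a rotation being at most 1 in absolute value.
  have key := eq_zero_of_norm_deriv_le_of_norm_le (ι := S) (T := T) (L := L) (B := 2)
    (f := fun R t => ((Φ R t : SO3) : Mat3) - (Ψ R t : SO3))
    (f' := fun R t => X (Φ R t) t - Y (Ψ R t) t) hLT
    (fun R => by simp only [(hΦ R R.2).1, (hΨ R R.2).1, sub_self])
    (fun R t ht => ((hΦ R R.2).2 t ht).sub ((hΨ R R.2).2 t ht))
    (fun R t _ => (norm_sub_le _ _).trans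
      (by linarith [norm_SO3_le_one (Φ R t : SO3), norm_SO3_le_one (Ψ R t : SO3)]))
    (fun D hD R t ht => h D (fun R hR t ht => hD ⟨R, hR⟩ t ht) R R.2 t ht)
  intro R hR t ht
  exact Subtype.ext (Subtype.ext (sub_eq_zero.1 (key ⟨R, hR⟩ t ht)))

/-! ### Push-forward from the support, existence and uniqueness. -/

/-- The restriction of a measure to its support, as a measure on the support. -/
noncomputable def supportMeasure {X : Type*} [TopologicalSpace X] [MeasurableSpace X]
    (μ : Measure X) : Measure μ.support := μ.comap Subtype.val

section Support

variable {X : Type*} [TopologicalSpace X] [MeasurableSpace X] [BorelSpace X]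
  [HereditarilyLindelofSpace X] (μ : Measure X)

theorem map_supportMeasure : (supportMeasure μ).map Subtype.val = μ := by
  rw [supportMeasure, map_comap_subtype_coe Measure.isClosed_support.measurableSet]
  exact Measure.restrict_eq_self_of_ae_mem Measure.support_mem_ae

instance instIsProbabilityMeasureSupportMeasure [IsProbabilityMeasure μ] :
    IsProbabilityMeasure (supportMeasure μ) := by
  have h := congrArg (fun m : Measure X => m univ) (map_supportMeasure μ)
  simp only [Measure.map_apply measurable_subtype_coe MeasurableSet.univ, preimage_univ,
    measure_univ] at h
  exact ⟨h⟩

end Support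

theorem velocity_eq_integral_flow {K : SO3 → SO3 → ℝ} {g : ℝ → ℝ}
    (hg : DifferentiableOn ℝ g (Ici 0))
    (hK : ∀ R Q : SO3, K R Q = g (riemannianDist R Q ^ 2)) {c₀ : ℝ} (h0 : -1 < c₀)
    (hw : LocallyLipschitz fun p : Mat3 × Mat3 => force g c₀ p.1 p.2) {U : Set SO3}
    (hU : ∀ R ∈ U, ∀ Q ∈ U, c₀ ≤ cosAngle R Q) {ρ : ℝ → ProbabilityMeasure U} {Ω : Type*}
    [MeasurableSpace Ω] {μ : Measure Ω} {Φ : Ω → ℝ → U} {t : ℝ}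
    (hρ : (ρ t : Measure U) = μ.map fun ω => Φ ω t) (hΦ : AEMeasurable (fun ω => Φ ω t) μ) (R : U) :
    velocity K ρ R t = ∫ ω, force g c₀ (R : SO3) (Φ ω t : SO3) ∂μ := by
  rw [velocity_eq hg hK h0 hw hU, hρ]
  refine integral_map hΦ (f := fun Q : U => force g c₀ (R : SO3) (Q : SO3)) ?_
  exact (hw.continuous_force continuous_const
    (continuous_coe_SO3.comp continuous_subtype_val)).aestronglyMeasurable

theorem continuousOn_probabilityMeasure_map {Ω X : Type*} [MeasurableSpace Ω] [TopologicalSpace X]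
    [MeasurableSpace X] [BorelSpace X] {ν : Measure Ω} [IsProbabilityMeasure ν]
    {P : Ω → ℝ → X} (hm : ∀ t, Measurable fun ω => P ω t) {s : Set ℝ}
    (hc : ∀ ω, ContinuousOn (P ω) s) {ρ : ℝ → ProbabilityMeasure X}
    (hρ : ∀ t, (ρ t : Measure X) = ν.map fun ω => P ω t) : ContinuousOn ρ s := by
  intro t ht
  refine ProbabilityMeasure.tendsto_iff_forall_integral_tendsto.2 fun f => ?_
  have e : ∀ u, ∫ x, f x ∂(ρ u : Measure X) = ∫ ω, f (P ω u) ∂ν := fun u => by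
    rw [hρ u]
    exact integral_map (hm u).aemeasurable f.continuous.measurable.aestronglyMeasurable
  simp only [e]
  refine tendsto_integral_filter_of_dominated_convergence (fun _ => ‖f‖)
    (Filter.Eventually.of_forall fun u =>
      (f.continuous.measurable.comp (hm u)).aestronglyMeasurable)
    (Filter.Eventually.of_forall fun u => Filter.Eventually.of_forall fun ω => f.norm_coe_le_norm _)
    (integrable_const _) (Filter.Eventually.of_forall fun ω => ?_)
  exact (f.continuous.tendsto _).comp (hc ω t ht)

theorem exists_unique_weakSolution {K : SO3 → SO3 → ℝ} {g : ℝ → ℝ}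
    (hg : DifferentiableOn ℝ g (Ici 0))
    (hK : ∀ R Q : SO3, K R Q = g (riemannianDist R Q ^ 2)) {c₀ r : ℝ} (h0 : -1 < c₀)
    (hw : LocallyLipschitz fun p : Mat3 × Mat3 => force g c₀ p.1 p.2)
    (hr0 : 0 < r) (hr : r ≤ Real.pi)
    (hU : ∀ R ∈ geodesicDisk r, ∀ Q ∈ geodesicDisk r, c₀ ≤ cosAngle R Q)
    (ρ₀ : ProbabilityMeasure (geodesicDisk r))
    (hρ₀ : IsCompact (ρ₀ : Measure (geodesicDisk r)).support) :
    ∃ T : ℝ, 0 < T ∧ ∃ ρ : ℝ → ProbabilityMeasure (geodesicDisk r),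
      IsWeakSolutionFrom K ρ₀ T ρ ∧
      ∀ σ : ℝ → ProbabilityMeasure (geodesicDisk r),
        IsWeakSolutionFrom K ρ₀ T σ → ∀ t ∈ Ico (0 : ℝ) T, σ t = ρ t := by
  classical
  set μ : Measure (geodesicDisk r) := (ρ₀ : Measure (geodesicDisk r)) with hμ
  set ν := supportMeasure μ with hν
  have : CompactSpace μ.support := isCompact_iff_compactSpace.1 hρ₀
  obtain ⟨τ, hτ, P, hP0, hPc, hPd⟩ := exists_flow hw hr0 hr ν ⟨Subtype.val, continuous_subtype_val⟩
  obtain ⟨L, C, hL0, hL, -⟩ := exists_bounds_of_locallyLipschitz (w := force g c₀) hw 1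
  -- The second term secures LT ≤ 1/2 for the contraction.
  set T := min τ (2 * (L + 1))⁻¹ with hT
  have hT0 : 0 < T := lt_min hτ (by positivity)
  have hLT : L * T ≤ 1 / 2 := by
    calc L * T ≤ L * (2 * (L + 1))⁻¹ := by gcongr; exact min_le_right _ _
      _ ≤ 1 / 2 := by rw [← div_eq_mul_inv, div_le_div_iff₀ (by positivity) (by norm_num)]; linarith
  have hsub : Ico 0 T ⊆ Ico 0 τ := Ico_subset_Ico_right (min_le_left _ _)
  have hPd' : ∀ x, ∀ t ∈ Ico 0 T, HasDerivWithinAt (fun s => ((P x s : SO3) : Mat3))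
        (∫ y, force g c₀ (P x t : SO3) (P y t : SO3) ∂ν) (Ico 0 T) t :=
    fun x t ht => (hPd x t (hsub ht)).mono hsub
  let ρ : ℝ → ProbabilityMeasure (geodesicDisk r) := fun t =>
    ⟨ν.map fun x => P x t, Measure.isProbabilityMeasure_map (hPc t).measurable.aemeasurable⟩
  have hρ : ∀ t, (ρ t : Measure (geodesicDisk r)) = ν.map fun x => P x t := fun t => rfl
  have hρ0 : ρ 0 = ρ₀ := by
    apply Subtype.ext
    change ν.map (fun x => P x 0) = μ
    simp only [hP0]
    exact map_supportMeasure μ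
  -- Off the support, a null set, the identity is an arbitrary choice that makes Ψ measurable.
  let Ψ : geodesicDisk r → ℝ → geodesicDisk r := fun R t =>
    if h : R ∈ μ.support then P ⟨R, h⟩ t else R
  have hΨP : ∀ (x : μ.support) t, Ψ x t = P x t := fun x t => dif_pos x.2
  have hΨm : ∀ t, Measurable fun R => Ψ R t := fun t => by
    refine measurable_of_restrict_of_restrict_compl
      (Measure.isClosed_support (μ := μ)).measurableSet ?_ ?_
    · exact (funext fun x => hΨP x t : μ.support.domRestrict (Ψ · t) = fun x => P x t) ▸
        (hPc t).measurable
    · exact (funext fun x => dif_neg x.2 : μ.supportᶜ.domRestrict (Ψ · t) = Subtype.val) ▸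
        measurable_subtype_coe
  have hρΨ : ∀ t, (ρ t : Measure (geodesicDisk r)) = μ.map fun R => Ψ R t := by
    intro t
    conv_rhs => rw [← map_supportMeasure μ, Measure.map_map (hΨm t) measurable_subtype_coe]
    rw [hρ]
    exact congrArg (Measure.map · ν) (funext fun x => (hΨP x t).symm)
  have hΨflow : IsFlowMap (velocity K ρ) μ.support T Ψ := by
    intro R hR
    have e : ∀ t, Ψ R t = P ⟨R, hR⟩ t := fun t => hΨP ⟨R, hR⟩ t
    refine ⟨by rw [e, hP0]; rfl, fun t ht => ?_⟩
    simp only [e]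
    rw [velocity_eq_integral_flow hg hK h0 hw hU (hρ t) (hPc t).measurable.aemeasurable]
    exact hPd' ⟨R, hR⟩ t ht
  refine ⟨T, hT0, ρ, ⟨?_, hρ0, Ψ, ?_, ?_, ?_⟩, ?_⟩
  · refine continuousOn_probabilityMeasure_map (fun t => (hPc t).measurable) (fun x t ht => ?_) hρ
    rw [Topology.IsInducing.subtypeVal.continuousWithinAt_iff,
      Topology.IsInducing.subtypeVal.continuousWithinAt_iff]
    exact (hPd' x t ht).continuousWithinAt
  · rw [hρ0]; exact hΨflow
  · rw [hρ0]
    -- Both flows follow the same field with ρ frozen, so the Lipschitz bound of the force in its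
    -- first argument is enough.
    intro Φ hΦ
    refine hΦ.eq_of_norm_sub_le hΨflow hLT fun D hD R hR t ht => ?_
    have hD0 : 0 ≤ D := (norm_nonneg _).trans (hD R hR t ht)
    rw [velocity_eq hg hK h0 hw hU, velocity_eq hg hK h0 hw hU]
    refine norm_integral_sub_integral_le
      (integrable_force hw _ measurable_subtype_coe.aemeasurable)
      (integrable_force hw _ measurable_subtype_coe.aemeasurable)
      (Filter.Eventually.of_forall fun Q => ?_)
    refine (hL _ _ _ _ (norm_SO3_le_one _) (norm_SO3_le_one _) (norm_SO3_le_one _)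
      (norm_SO3_le_one _)).trans ?_
    gcongr
    exact max_le (hD R hR t ht) (by rwa [sub_self, norm_zero])
  · intro t _
    rw [hρ0]; exact hρΨ t
  · rintro σ ⟨-, hσ0, Φ, hΦ, -, hσΦ⟩
    rw [hσ0] at hΦ hσΦ
    have hΦm : ∀ t ∈ Ico 0 T, AEMeasurable (fun R => Φ R t) μ := by
      -- `Measure.map` by a map that is not a.e. measurable is 0, which is not a probability
      -- measure.
      intro t ht
      by_contra hne
      have h1 := hσΦ t ht
      rw [Measure.map_of_not_aemeasurable hne] at h1
      exact IsProbabilityMeasure.ne_zero _ h1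
    -- The two fields differ here; written as integrals over ρ₀, their difference is controlled by
    -- the gap of the flows at both R and Q.
    have heq : ∀ R ∈ μ.support, ∀ t ∈ Ico 0 T, Φ R t = Ψ R t := by
      refine IsFlowMap.eq_of_norm_sub_le hΦ hΨflow hLT fun D hD R hR t ht => ?_
      rw [velocity_eq_integral_flow hg hK h0 hw hU (hσΦ t ht) (hΦm t ht),
        velocity_eq_integral_flow hg hK h0 hw hU (hρΨ t) (hΨm t).aemeasurable]
      refine norm_integral_sub_integral_le
        (integrable_force hw _ (measurable_subtype_coe.comp_aemeasurable (hΦm t ht)))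
        (integrable_force hw _ (measurable_subtype_coe.comp_aemeasurable (hΨm t).aemeasurable)) ?_
      filter_upwards [Measure.support_mem_ae (μ := μ)] with Q hQ
      refine (hL _ _ _ _ (norm_SO3_le_one _) (norm_SO3_le_one _) (norm_SO3_le_one _)
        (norm_SO3_le_one _)).trans ?_
      gcongr
      exact max_le (hD R hR t ht) (hD Q hQ t ht)
    intro t ht
    apply Subtype.ext
    change (σ t : Measure (geodesicDisk r)) = (ρ t : Measure (geodesicDisk r))
    rw [hσΦ t ht, hρΨ t]
    refine Measure.map_congr ?_
    filter_upwards [Measure.support_mem_ae (μ := μ)] with Q hQ using heq Q hQ t ht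

end AggregationSO3

theorem mainTheorem1 (K : AggregationSO3.SO3 → AggregationSO3.SO3 → ℝ)
    (hK : AggregationSO3.IsAdmissiblePotential K)
    (ε : ℝ) (hε : 0 < ε) (hε' : ε < Real.pi / 2)
    (ρ₀ : ProbabilityMeasure (AggregationSO3.geodesicDisk (Real.pi / 2 - ε)))
    (hρ₀ : IsCompact (ρ₀ : Measure (AggregationSO3.geodesicDisk (Real.pi / 2 - ε))).support) :
    ∃ T : ℝ, 0 < T ∧
      ∃ ρ : ℝ → ProbabilityMeasure (AggregationSO3.geodesicDisk (Real.pi / 2 - ε)),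
        AggregationSO3.IsWeakSolutionFrom K ρ₀ T ρ ∧
        ∀ σ : ℝ → ProbabilityMeasure (AggregationSO3.geodesicDisk (Real.pi / 2 - ε)),
          AggregationSO3.IsWeakSolutionFrom K ρ₀ T σ → ∀ t ∈ Set.Ico (0 : ℝ) T, σ t = ρ t := by
  obtain ⟨g, hg, hg', hKg⟩ := hK
  -- The margin ε keeps the largest angle π − 2ε strictly below π, giving the clamp c₀ = cos(π − 2ε)
  -- > −1.
  have hc : -1 < Real.cos (2 * (Real.pi / 2 - ε)) := by
    rw [← Real.cos_pi]
    exact Real.cos_lt_cos_of_nonneg_of_le_pi (by linarith) le_rfl (by linarith)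
  exact AggregationSO3.exists_unique_weakSolution hg hKg hc
    (AggregationSO3.locallyLipschitz_force hg' hc (Real.cos_le_one _)) (by linarith)
    (by linarith [Real.pi_pos])
    (fun R hR Q hQ => (AggregationSO3.cos_two_mul_lt_cosAngle (by linarith) hR hQ).le) ρ₀ hρ₀
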